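/- Let $G$ be a connected finite simple graph and let $\varphi$ assign to each oriented edge $u\to v$ of $G$ a complex number $\varphi_{uv}$ with $|\varphi_{uv}|=1$ and $\varphi_{vu}=\varphi_{uv}^{-1}$, so that $G^{\varphi}$ is a connected complex unit gain graph. Its adjacency matrix $A(G^{\varphi})$ is the Hermitian matrix with $(u,v)$-entry $\varphi_{uv}$ if $uv\in E(G)$ and $0$ otherwise. Let $p(G^{\varphi})$ be the number of positive eigenvalues of $A(G^{\varphi})$, counted with multiplicity. For a finite graph $H$ let $m(H)$ be the maximum number of edges of a matching of $H$ (so $m(H)=0$ if $H$ has no vertices), and let $c(G)=|E(G)|-|V(G)|+\omega(G)$, where $\omega(G)$ is the number of connected components of $G$. Then $$p(G^{\varphi})=m(G)-c(G)$$ if and only if the following three conditions all hold: (a) any two distinct cycles of $G$ have no common vertices; (b) every cycle $v_1v_2\cdots v_nv_1$ of $G$ is of Type A, that is, $n$ is even and $\varphi_{v_1v_2}\varphi_{v_2v_3}\cdots\varphi_{v_{n-1}v_n}\varphi_{v_nv_1}=(-1)^{n/2}$; (c) $m(T_G)=m(G-O(G))$, where $O(G)$ is the set of vertices of $G$ that lie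 on cycles, $G-O(G)$ is the subgraph induced on the remaining vertices, and $T_G$ is the graph obtained from $G$ by contracting each cycle to a single vertex (defined when (a) holds). -/

import Mathlib

noncomputable section

namespace SimpleGraph

variable {V : Type*}

/-- The matching number `m(G)`: the largest number of edges of a matching of `G`. -/
def matchingNumber (G : SimpleGraph V) : ℕ :=
  sSup {k : ℕ | ∃ M : G.Subgraph, M.IsMatching ∧ M.edgeSet.ncard = k}

/-- The cyclomatic number `c(G) = |E(G)| - |V(G)| + ω(G)`, where `ω(G)` is the number of connected
components; it is used for finite graphs only. -/
def cyclomaticNumber (G : SimpleGraph V) : ℤ :=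
  (G.edgeSet.ncard : ℤ) - (Nat.card V : ℤ) + (Nat.card G.ConnectedComponent : ℤ)

/-- The subgraph `C` of `G` is a cycle: it is traced out by a closed walk of length at least `3`
that repeats no vertex apart from its endpoints. -/
def IsCycleSubgraph (G : SimpleGraph V) (C : G.Subgraph) : Prop :=
  ∃ (v : V) (p : G.Walk v v), p.IsCycle ∧ p.toSubgraph = C

/-- Any two distinct cycles of `G` have no common vertices. -/
def CyclesVertexDisjoint (G : SimpleGraph V) : Prop :=
  ∀ C D : G.Subgraph, G.IsCycleSubgraph C → G.IsCycleSubgraph D → C ≠ D →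
    Disjoint C.verts D.verts

/-- `O(G)`: the set of vertices that lie on some cycle of `G`. -/
def cycleVertices (G : SimpleGraph V) : Set V :=
  {v | ∃ C : G.Subgraph, G.IsCycleSubgraph C ∧ v ∈ C.verts}

/-- The equivalence relation on vertices that is generated by identifying any two vertices of the
same cycle. If the cycles of `G` are pairwise vertex-disjoint, its classes are the vertex sets of
the cycles and the singletons of the vertices on no cycle. -/
def cycleSetoid (G : SimpleGraph V) : Setoid V :=
  Relation.EqvGen.setoid fun u v =>
    ∃ C : G.Subgraph, G.IsCycleSubgraph C ∧ u ∈ C.verts ∧ v ∈ C.verts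

/-- `T_G`: the simple graph obtained from `G` by contracting each cycle of `G` to a vertex. Two
distinct classes are adjacent if and only if some edge of `G` joins them. -/
def cycleContraction (G : SimpleGraph V) : SimpleGraph (Quotient G.cycleSetoid) :=
  G.map (Quotient.mk G.cycleSetoid)

end SimpleGraph

/-- A complex unit gain function on `G`: every oriented edge (dart) carries a complex number of
modulus `1`, and reversing the orientation inverts it. A pair consisting of a graph `G` and such a
function is a complex unit gain graph. -/
structure ComplexUnitGain {V : Type*} (G : SimpleGraph V) where
  gain : G.Dart → Circle
  gain_symm : ∀ d : G.Dart, gain d.symm = (gain d)⁻¹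

namespace ComplexUnitGain

variable {V : Type*} {G : SimpleGraph V}

open Classical in
/-- The adjacency matrix of a complex unit gain graph: the entry at `(i, j)` is the gain of the
oriented edge from `i` to `j`, or `0` if `i` and `j` are not adjacent. -/
def adjMatrix (φ : ComplexUnitGain G) : Matrix V V ℂ :=
  Matrix.of fun i j => if h : G.Adj i j then (φ.gain ⟨(i, j), h⟩ : ℂ) else 0

theorem isHermitian_adjMatrix (φ : ComplexUnitGain G) : φ.adjMatrix.IsHermitian := by
  ext i j
  by_cases h : G.Adj i j
  · have key := φ.gain_symm ⟨(i, j), h⟩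
    have key' : φ.gain ⟨(j, i), h.symm⟩ = (φ.gain ⟨(i, j), h⟩)⁻¹ := key
    simp only [adjMatrix, Matrix.conjTranspose_apply, Matrix.of_apply, h, h.symm, dite_true, key',
      Circle.coe_inv_eq_conj]
    simp
  · have h' : ¬ G.Adj j i := fun h' => h h'.symm
    simp [adjMatrix, h, h']

/-- The positive inertia index `p(G^φ)`: the number of positive eigenvalues of the adjacency
matrix, counted with multiplicity. -/
def posInertia [Fintype V] [DecidableEq V] (φ : ComplexUnitGain G) : ℕ :=
  Nat.card {i : V // 0 < φ.isHermitian_adjMatrix.eigenvalues i}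

/-- The gain of a walk: the product of the gains of its successive oriented edges. -/
def walkGain (φ : ComplexUnitGain G) {u v : V} (p : G.Walk u v) : ℂ :=
  (p.darts.map fun d => (φ.gain d : ℂ)).prod

/-- The cycle `C` is of Type A: for every closed walk that traces it out (whatever the starting
vertex and the direction), its length `n` is even and its gain is `(-1) ^ (n / 2)`. -/
def IsTypeA (φ : ComplexUnitGain G) (C : G.Subgraph) : Prop :=
  ∀ (v : V) (p : G.Walk v v), p.IsCycle → p.toSubgraph = C →
    Even p.length ∧ φ.walkGain p = (-1) ^ (p.length / 2)

end ComplexUnitGain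

end

/-! Write p, m, c for the positive inertia index, the matching number and the cyclomatic number. The
inequality p ≥ m - c holds for every graph, by peeling. Deleting a vertex on a cycle lowers m by at
most 1 and c by at least 1, and cannot raise p. Deleting the neighbour of a pendant vertex lowers p
by at least 1 and m by at most 1, and does not raise c. This is
`matchingNumber_sub_cyclomaticNumber_le`.

If equality holds for G (`Tight`), it therefore holds for each peeled graph, and every inequality
used in the peeling is an equality. A vertex on a cycle then lowers c by exactly 1, which forces the
cycles to be disjoint (`maxDegTwo_cyclePart`). Peeling down to a single cycle shows that it is of
Type A (`Tight.prod_eq`): an odd length contradicts the count of matching edges, and a wrong gain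
makes p too large.

Condition (c) becomes a statement about vertex covers. As T_G is a forest, König's theorem turns
m(T_G) = m(G - O(G)) into the existence of a set K of vertices on no cycle that covers all bridges
and has at most m(G - O(G)) elements (`matchingNumber_cycleContraction_eq_iff`). Equality yields
such a K by peeling pendant vertices and end cycles (`Tight.exists_cover`). Conversely, deleting K
leaves exactly the disjoint cycles, for which p ≤ m - c because a Type A cycle carries a null
vector. Each vertex of K costs at most 1, so p(G) ≤ m(G) - c(G) (`tight_of_cover`).

The index p is treated variationally, as the largest dimension of a positive definite subspace.
Vertices are isolated rather than removed, and weights are given on all pairs, so that all graphs in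
an induction share one vertex type and one weight. -/

namespace SimpleGraph

variable {V : Type*} {G H : SimpleGraph V}

/-! ### Isolating vertices, and the edges that lie on cycles -/

/-- The graph obtained from `G` by deleting all edges that touch `X`: the vertices of `X` are kept
as isolated vertices. -/
def isolate (G : SimpleGraph V) (X : Set V) : SimpleGraph V where
  Adj u v := G.Adj u v ∧ u ∉ X ∧ v ∉ X
  symm := ⟨fun _ _ h => ⟨h.1.symm, h.2.2, h.2.1⟩⟩
  loopless := ⟨fun _ h => G.loopless.irrefl _ h.1⟩

lemma isolate_adj {X : Set V} {u v : V} :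
    (G.isolate X).Adj u v ↔ G.Adj u v ∧ u ∉ X ∧ v ∉ X := Iff.rfl

lemma isolate_le (X : Set V) : G.isolate X ≤ G := fun _ _ h => h.1

lemma isolate_mono (h : G ≤ H) (X : Set V) : G.isolate X ≤ H.isolate X :=
  fun _ _ h' => ⟨h h'.1, h'.2⟩

lemma isolate_anti {X Y : Set V} (h : X ⊆ Y) : G.isolate Y ≤ G.isolate X :=
  fun _ _ h' => ⟨h'.1, fun hx => h'.2.1 (h hx), fun hx => h'.2.2 (h hx)⟩

lemma isolate_isolate (X Y : Set V) : (G.isolate X).isolate Y = G.isolate (X ∪ Y) := by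
  ext u v
  simp only [isolate_adj, Set.mem_union]
  tauto

lemma isolate_empty : G.isolate ∅ = G := by
  ext u v
  simp [isolate_adj]

lemma ncard_edgeSet_isolate_lt [Finite V] {X : Set V} {x y : V} (hx : x ∈ X) (h : G.Adj x y) :
    (G.isolate X).edgeSet.ncard < G.edgeSet.ncard := by
  refine Set.ncard_lt_ncard ⟨edgeSet_mono (isolate_le X), fun h' => ?_⟩ (Set.toFinite _)
  have : s(x, y) ∈ (G.isolate X).edgeSet := h' h
  exact this.2.1 hx

/-- The union of the cycles of `G`: the spanning subgraph of the edges that are not bridges. -/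
def cyclePart (G : SimpleGraph V) : SimpleGraph V where
  Adj u v := G.Adj u v ∧ (G.deleteEdges {s(u, v)}).Reachable u v
  symm := ⟨fun u v h => ⟨h.1.symm, by rw [Sym2.eq_swap]; exact h.2.symm⟩⟩
  loopless := ⟨fun _ h => G.loopless.irrefl _ h.1⟩

lemma cyclePart_le : G.cyclePart ≤ G := fun _ _ h => h.1

lemma cyclePart_mono (h : G ≤ H) : G.cyclePart ≤ H.cyclePart :=
  fun _ _ h' => ⟨h h'.1, h'.2.mono (deleteEdges_mono h)⟩

/-- Every vertex has at most two neighbours. -/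
def MaxDegTwo (G : SimpleGraph V) : Prop :=
  ∀ ⦃x a b d : V⦄, G.Adj x a → G.Adj x b → G.Adj x d → a = b ∨ a = d ∨ b = d

lemma MaxDegTwo.mono (h : G ≤ H) (hH : H.MaxDegTwo) : G.MaxDegTwo :=
  fun _ _ _ _ h1 h2 h3 => hH (h h1) (h h2) (h h3)

/-! ### Cycles as periodic sequences -/

/-- `c` runs periodically, with period `n`, around a cycle of length `n` of `G`. -/
structure IsCyclicSeq (G : SimpleGraph V) (n : ℕ) (c : ℕ → V) : Prop where
  three_le : 3 ≤ n
  periodic : ∀ i, c (i + n) = c i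
  modEq : ∀ i j, c i = c j → i ≡ j [MOD n]
  adj : ∀ i, G.Adj (c i) (c (i + 1))

namespace IsCyclicSeq

variable {n m : ℕ} {c d : ℕ → V}

lemma mono (hc : G.IsCyclicSeq n c) (h : G ≤ H) : H.IsCyclicSeq n c :=
  { hc with adj := fun i => h (hc.adj i) }

lemma shift (hc : G.IsCyclicSeq n c) (k : ℕ) : G.IsCyclicSeq n (fun i => c (i + k)) where
  three_le := hc.three_le
  periodic i := by rw [show i + n + k = i + k + n by omega]; exact hc.periodic _
  modEq i j h := Nat.ModEq.add_right_cancel' k (hc.modEq _ _ h)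
  adj i := by rw [show i + 1 + k = i + k + 1 by omega]; exact hc.adj _

lemma apply_add_mul (hc : G.IsCyclicSeq n c) (i k : ℕ) : c (i + k * n) = c i := by
  induction k with
  | zero => simp
  | succ k ih => rw [show i + (k + 1) * n = i + k * n + n by ring, hc.periodic, ih]

lemma apply_mod (hc : G.IsCyclicSeq n c) (i : ℕ) : c (i % n) = c i := by
  conv_rhs => rw [← Nat.mod_add_div i n, mul_comm]
  exact (hc.apply_add_mul _ _).symm

lemma apply_eq_of_modEq (hc : G.IsCyclicSeq n c) {i j : ℕ} (h : i ≡ j [MOD n]) : c i = c j := by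
  rw [← hc.apply_mod i, ← hc.apply_mod j, h]

lemma eq_of_lt (hc : G.IsCyclicSeq n c) {i j : ℕ} (hi : i < n) (hj : j < n) (h : c i = c j) :
    i = j := Nat.ModEq.eq_of_lt_of_lt (hc.modEq _ _ h) hi hj

lemma adj_pred (hc : G.IsCyclicSeq n c) (i : ℕ) : G.Adj (c i) (c (i + (n - 1))) := by
  have h := hc.adj (i + (n - 1))
  have h3 := hc.three_le
  rw [show i + (n - 1) + 1 = i + n by omega, hc.periodic] at h
  exact h.symm

lemma succ_ne_pred (hc : G.IsCyclicSeq n c) (i : ℕ) : c (i + 1) ≠ c (i + (n - 1)) := by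
  intro h
  have h3 := hc.three_le
  have := Nat.ModEq.add_left_cancel' i (hc.modEq _ _ h)
  have := Nat.ModEq.eq_of_lt_of_lt this (by omega) (by omega)
  omega

/-- An arc of a cycle connects its ends while avoiding the remaining edges. -/
lemma reachable_arc {K : SimpleGraph V} (i k : ℕ)
    (h : ∀ j, i ≤ j → j < i + k → K.Adj (c j) (c (j + 1))) : K.Reachable (c i) (c (i + k)) := by
  induction k with
  | zero => exact Reachable.refl _
  | succ k ih =>
    exact (ih fun j h1 h2 => h j h1 (by omega)).trans (h (i + k) (by omega) (by omega)).reachable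

/-- Each edge of a cycle is bypassed by the complementary arc of `n - 1` edges, so it is not a
bridge. -/
lemma cyclePart (hc : G.IsCyclicSeq n c) : G.cyclePart.IsCyclicSeq n c := by
  refine { hc with adj := fun i => ⟨hc.adj i, ?_⟩ }
  have h3 := hc.three_le
  have key : (G.deleteEdges {s(c i, c (i + 1))}).Reachable (c (i + 1)) (c (i + 1 + (n - 1))) := by
    refine reachable_arc _ _ fun j h1 h2 => ?_
    rw [deleteEdges_adj]
    refine ⟨hc.adj j, ?_⟩
    simp only [Set.mem_singleton_iff, Sym2.eq_iff, not_or, not_and]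
    have aux : c j ≠ c i := by
      intro h
      have h' := hc.modEq _ _ h
      have := (Nat.modEq_iff_dvd' (by omega : i ≤ j)).mp h'.symm
      have := Nat.le_of_dvd (by omega) this
      omega
    -- An arc edge equal to the deleted one with reversed ends would make `n` divide both `j - i -
    -- 1` and `j - i + 1`, hence 2.
    refine ⟨fun h => absurd h aux, fun h1' h2' => ?_⟩
    have e1 := (Nat.modEq_iff_dvd' (by omega : i + 1 ≤ j)).mp (hc.modEq _ _ h1').symm
    have e2 := (Nat.modEq_iff_dvd' (by omega : i ≤ j + 1)).mp (hc.modEq _ _ h2').symm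
    have e3 : n ∣ 2 := by
      have := Nat.dvd_sub e2 e1
      rwa [show j + 1 - i - (j - (i + 1)) = 2 by omega] at this
    have := Nat.le_of_dvd (by omega) e3
    omega
  rw [show i + 1 + (n - 1) = i + n by omega, hc.periodic] at key
  exact key.symm

lemma eq_or_eq_of_adj (hc : G.IsCyclicSeq n c) (h2 : G.MaxDegTwo) {i : ℕ} {z : V}
    (h : G.Adj (c i) z) : z = c (i + 1) ∨ z = c (i + (n - 1)) := by
  rcases h2 h (hc.adj i) (hc.adj_pred i) with h | h | h
  · exact Or.inl h
  · exact Or.inr h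
  · exact absurd h (hc.succ_ne_pred i)

lemma exists_edge_of_adj (hc : G.IsCyclicSeq n c) (h2 : G.MaxDegTwo) {i : ℕ} {z : V}
    (h : G.Adj (c i) z) : ∃ j, s(c i, z) = s(c j, c (j + 1)) ∧ z ∈ Set.range c := by
  rcases hc.eq_or_eq_of_adj h2 h with rfl | rfl
  · exact ⟨i, rfl, _, rfl⟩
  · refine ⟨i + (n - 1), ?_, _, rfl⟩
    have h3 := hc.three_le
    rw [show i + (n - 1) + 1 = i + n by omega, hc.periodic, Sym2.eq_swap]

lemma mem_range_of_adj (hc : G.IsCyclicSeq n c) (h2 : G.MaxDegTwo) {y z : V}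
    (hy : y ∈ Set.range c) (h : G.Adj y z) : z ∈ Set.range c := by
  obtain ⟨i, rfl⟩ := hy
  exact (hc.exists_edge_of_adj h2 h).choose_spec.2

/-- Under the degree bound a cycle is closed under adjacency, so a second cycle that meets it can
never leave it. -/
lemma range_subset (hc : G.IsCyclicSeq n c) (h2 : G.MaxDegTwo) (hd : G.IsCyclicSeq m d) {j : ℕ}
    (hj : d j ∈ Set.range c) : Set.range d ⊆ Set.range c := by
  have key : ∀ k, d (j + k) ∈ Set.range c := by
    intro k
    induction k with
    | zero => exact hj
    | succ k ih => exact hc.mem_range_of_adj h2 ih (hd.adj _)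
  rintro _ ⟨k, rfl⟩
  have h3 := hd.three_le
  have key2 := key (k + j * (m - 1))
  -- Only indices after `j` are known so far; `j` further turns around `d` reach the index `k`
  -- itself.
  have : j + (k + j * (m - 1)) = k + j * m := by
    obtain ⟨m, rfl⟩ : ∃ m', m = m' + 1 := ⟨m - 1, by omega⟩
    simp only [Nat.add_sub_cancel]; ring
  rwa [this, hd.apply_add_mul] at key2

lemma ncard_range (hc : G.IsCyclicSeq n c) : (Set.range c).ncard = n := by
  have h3 := hc.three_le
  have : Set.range c = c '' (Set.Iio n) := by
    ext v
    constructor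
    · rintro ⟨i, rfl⟩
      exact ⟨i % n, Nat.mod_lt _ (by omega), hc.apply_mod i⟩
    · rintro ⟨i, -, rfl⟩
      exact ⟨i, rfl⟩
  have hinj : Set.InjOn c (Set.Iio n) := fun i hi j hj h => hc.eq_of_lt hi hj h
  rw [this, hinj.ncard_image]
  simp [Set.ncard_eq_toFinset_card']

end IsCyclicSeq

lemma Walk.IsCycle.isCyclicSeq {v : V} {p : G.Walk v v} (hp : p.IsCycle) :
    G.IsCyclicSeq p.length (fun i => p.getVert (i % p.length)) := by
  have h3 := hp.three_le_length
  refine ⟨h3, fun i => by simp, fun i j h => ?_, fun i => ?_⟩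
  · have hi : i % p.length < p.length := Nat.mod_lt _ (by omega)
    have hj : j % p.length < p.length := Nat.mod_lt _ (by omega)
    exact hp.getVert_injOn' (by simp; omega) (by simp; omega) h
  · have hi : i % p.length < p.length := Nat.mod_lt _ (by omega)
    have : p.getVert ((i + 1) % p.length) = p.getVert (i % p.length + 1) := by
      rw [Nat.add_mod, Nat.mod_eq_of_lt (by omega : 1 < p.length)]
      rcases Nat.lt_or_ge (i % p.length + 1) p.length with h | h
      · rw [Nat.mod_eq_of_lt h]
      · have : i % p.length + 1 = p.length := by omega
        rw [this, Nat.mod_self]; simp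
    simp only [this]
    exact p.adj_getVert_succ hi

lemma Walk.IsCycle.range_getVert_mod {v : V} {p : G.Walk v v} (hp : p.IsCycle) :
    Set.range (fun i => p.getVert (i % p.length)) = {x | x ∈ p.support} := by
  have h3 := hp.three_le_length
  ext x
  constructor
  · rintro ⟨i, rfl⟩
    exact p.getVert_mem_support _
  · intro hx
    obtain ⟨i, rfl, hi⟩ := Walk.mem_support_iff_exists_getVert.mp hx
    rcases hi.lt_or_eq with h | h
    · exact ⟨i, by simp [Nat.mod_eq_of_lt h]⟩
    · exact ⟨0, by simp [h]⟩

lemma exists_isCycle_of_cyclePart_adj {u v : V} (h : G.cyclePart.Adj u v) :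
    ∃ p : G.Walk u u, p.IsCycle ∧ p.getVert 1 = v ∧ s(u, v) ∈ p.edges := by
  classical
  obtain ⟨h, hr⟩ := h
  obtain ⟨q, hq⟩ := reachable_deleteEdges_iff_exists_walk.mp hr.symm
  refine ⟨Walk.cons h q.toPath, ?_, by simp, by simp⟩
  exact Path.cons_isCycle _ _ fun h' => hq (Walk.edges_toPath_subset_edges q h')

lemma exists_isCyclicSeq_of_cyclePart_adj {u v : V} (h : G.cyclePart.Adj u v) :
    ∃ n c, G.IsCyclicSeq n c ∧ c 0 = u ∧ c 1 = v := by
  obtain ⟨p, hp, h1, -⟩ := exists_isCycle_of_cyclePart_adj h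
  have h3 := hp.three_le_length
  exact ⟨_, _, hp.isCyclicSeq, by simp, by simp [Nat.mod_eq_of_lt (by omega : 1 < p.length), h1]⟩

/-- Deleting vertices on no cycle does not change the cycles. -/
lemma cyclePart_isolate {X : Set V} (hX : ∀ x ∈ X, x ∉ G.cyclePart.support) :
    (G.isolate X).cyclePart = G.cyclePart := by
  refine le_antisymm (cyclePart_mono (isolate_le X)) fun u v h => ?_
  obtain ⟨n, c, hc, rfl, rfl⟩ := exists_isCyclicSeq_of_cyclePart_adj h
  have key : ∀ i, c i ∉ X := fun i hi => hX _ hi ⟨_, hc.cyclePart.adj i⟩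
  have hc' : (G.isolate X).IsCyclicSeq n c := { hc with adj := fun i => ⟨hc.adj i, key _, key _⟩ }
  exact hc'.cyclePart.adj 0

/-! ### Matching numbers and vertex covers -/

/-- The edges of `M` are pairwise disjoint. -/
def MaxDegOne (M : SimpleGraph V) : Prop := ∀ ⦃x a b : V⦄, M.Adj x a → M.Adj x b → a = b

lemma bddAbove_matching [Finite V] (G : SimpleGraph V) :
    BddAbove {k : ℕ | ∃ M : G.Subgraph, M.IsMatching ∧ M.edgeSet.ncard = k} := by
  refine ⟨G.edgeSet.ncard, ?_⟩
  rintro _ ⟨M, -, rfl⟩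
  exact Set.ncard_le_ncard M.edgeSet_subset (Set.toFinite _)

lemma MaxDegOne.ncard_le_matchingNumber [Finite V] {M : SimpleGraph V} (hM : M.MaxDegOne)
    (h : M ≤ G) : M.edgeSet.ncard ≤ G.matchingNumber := by
  refine le_csSup (bddAbove_matching G) ?_
  refine ⟨⟨M.support, M.Adj, fun h' => h h', fun h' => ⟨_, h'⟩, M.symm⟩, ?_, ?_⟩
  · rintro v ⟨w, hw⟩
    exact ⟨w, hw, fun y hy => hM hy hw⟩
  · rfl

lemma exists_maxDegOne [Finite V] (G : SimpleGraph V) :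
    ∃ M ≤ G, M.MaxDegOne ∧ M.edgeSet.ncard = G.matchingNumber := by
  obtain ⟨M, hM, h⟩ := Nat.sSup_mem (s := {k : ℕ | ∃ M : G.Subgraph, M.IsMatching ∧
    M.edgeSet.ncard = k}) ⟨_, ⊥, by simp [Subgraph.IsMatching], rfl⟩ (bddAbove_matching G)
  refine ⟨M.spanningCoe, M.spanningCoe_le, fun x a b ha hb => ?_, ?_⟩
  · exact (hM (M.edge_vert ha)).unique ha hb
  · rw [Subgraph.edgeSet_spanningCoe, h]
    rfl

lemma matchingNumber_mono [Finite V] (h : G ≤ H) : G.matchingNumber ≤ H.matchingNumber := by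
  obtain ⟨M, hM, h1, h2⟩ := exists_maxDegOne G
  exact h2 ▸ h1.ncard_le_matchingNumber (hM.trans h)

lemma matchingNumber_le_of_embedding {W : Type*} [Finite V] [Finite W] {K : SimpleGraph W}
    (f : V ↪ W) (h : ∀ u v, G.Adj u v → K.Adj (f u) (f v)) :
    G.matchingNumber ≤ K.matchingNumber := by
  obtain ⟨M, hM, h1, h2⟩ := exists_maxDegOne G
  have hle : M.map f ≤ K := by
    rw [map_le_iff_le_comap]
    intro u v huv
    exact h u v (hM huv)
  have h1' : (M.map f).MaxDegOne := by
    intro x a b ha hb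
    rw [map_adj] at ha hb
    obtain ⟨x', a', ha, rfl, rfl⟩ := ha
    obtain ⟨x'', b', hb, hx, rfl⟩ := hb
    rw [f.injective hx] at hb
    rw [h1 ha hb]
  rw [← h2]
  refine le_trans (le_of_eq ?_) (h1'.ncard_le_matchingNumber hle)
  rw [edgeSet_map f M, Set.ncard_image_of_injective _ (Function.Embedding.injective _)]

/-- Both ends of `u w` are isolated in `H`, so this edge extends every matching of `H`. -/
lemma matchingNumber_isolate_add_le [Finite V] {u w : V} (hle : H ≤ G) (h : G.Adj u w)
    (hu : ∀ z, ¬ H.Adj u z) (hw : ∀ z, ¬ H.Adj w z) :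
    H.matchingNumber + 1 ≤ G.matchingNumber := by
  obtain ⟨M, hM, h1, h2⟩ := exists_maxDegOne H
  have hne := h.ne
  have hM' : (M ⊔ edge u w).MaxDegOne := by
    intro x a b ha hb
    have h3 := fun z (hz : M.Adj u z) => hu z (hM hz)
    have h4 := fun z (hz : M.Adj w z) => hw z (hM hz)
    rw [sup_adj, edge_adj] at ha hb
    rcases ha with ha | ⟨⟨rfl, rfl⟩ | ⟨rfl, rfl⟩, -⟩ <;>
    rcases hb with hb | ⟨⟨h5, h6⟩ | ⟨h5, h6⟩, -⟩
    · exact h1 ha hb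
    all_goals grind
  have hle' : M ⊔ edge u w ≤ G := by
    refine sup_le (hM.trans hle) ?_
    intro a b hab
    rw [edge_adj] at hab
    rcases hab with ⟨⟨rfl, rfl⟩ | ⟨rfl, rfl⟩, -⟩
    · exact h
    · exact h.symm
  have := hM'.ncard_le_matchingNumber hle'
  rw [edgeSet_sup, edgeSet_edge_of_ne hne, Set.union_singleton, Set.ncard_insert_of_notMem] at this
  · omega
  · exact fun h' => hu w (hM h')

lemma matchingNumber_le_isolate_add_one [Finite V] (G : SimpleGraph V) (x : V) :
    G.matchingNumber ≤ (G.isolate {x}).matchingNumber + 1 := by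
  obtain ⟨M, hM, h1, h2⟩ := exists_maxDegOne G
  have h3 : (M.isolate {x}).MaxDegOne := fun _ _ _ ha hb => h1 ha.1 hb.1
  have h4 := h3.ncard_le_matchingNumber (isolate_mono hM _)
  by_cases hx : ∃ y, M.Adj x y
  · obtain ⟨y, hy⟩ := hx
    have : M.edgeSet ⊆ insert s(x, y) (M.isolate {x}).edgeSet := by
      intro e
      induction e with | _ a b =>
      intro (hab : M.Adj a b)
      by_cases ha : a = x
      · subst ha
        rw [h1 hab hy]; exact Set.mem_insert _ _
      by_cases hb : b = x
      · subst hb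
        rw [h1 hab.symm hy, Sym2.eq_swap]; exact Set.mem_insert _ _
      · exact Or.inr ⟨hab, ha, hb⟩
    have h5 := Set.ncard_le_ncard this (Set.toFinite _)
    have := Set.ncard_insert_le s(x, y) (M.isolate {x}).edgeSet
    omega
  · push Not at hx
    have : M ≤ M.isolate {x} := by
      intro a b hab
      refine ⟨hab, ?_, ?_⟩
      · rintro rfl; exact hx _ hab
      · rintro rfl; exact hx _ hab.symm
    have := Set.ncard_le_ncard (edgeSet_mono this) (Set.toFinite _)
    omega

lemma matchingNumber_le_isolate_add_ncard [Finite V] (G : SimpleGraph V) (K : Set V) :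
    G.matchingNumber ≤ (G.isolate K).matchingNumber + K.ncard := by
  induction K, K.toFinite using Set.Finite.induction_on with
  | empty => simp [isolate_empty]
  | @insert a s ha hs ih =>
    rw [Set.ncard_insert_of_notMem ha hs]
    have := matchingNumber_le_isolate_add_one (G.isolate s) a
    rw [isolate_isolate, Set.union_singleton] at this
    omega

@[simp] lemma matchingNumber_bot [Finite V] : (⊥ : SimpleGraph V).matchingNumber = 0 := by
  obtain ⟨M, hM, -, h2⟩ := exists_maxDegOne (⊥ : SimpleGraph V)
  rw [← h2, le_bot_iff.mp hM]
  simp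

lemma matchingNumber_le_of_cover [Finite V] {K : Set V}
    (h : ∀ u v, G.Adj u v → u ∈ K ∨ v ∈ K) : G.matchingNumber ≤ K.ncard := by
  have := matchingNumber_le_isolate_add_ncard G K
  have h0 : G.isolate K = ⊥ := by
    ext u v
    simp only [isolate_adj, bot_adj, iff_false, not_and, not_not]
    intro h1 h2
    exact (h u v h1).resolve_left h2
  rw [h0, matchingNumber_bot] at this
  omega

lemma MaxDegOne.two_mul_ncard [Finite V] {M : SimpleGraph V} (hM : M.MaxDegOne) :
    2 * M.edgeSet.ncard = M.support.ncard := by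
  classical
  have := Fintype.ofFinite V
  have h := M.sum_degrees_eq_twice_card_edges
  have hd : ∀ v, M.degree v = if v ∈ M.support then 1 else 0 := by
    intro v
    split_ifs with hv
    · obtain ⟨w, hw⟩ := hv
      rw [← card_neighborFinset_eq_degree, Finset.card_eq_one]
      refine ⟨w, ?_⟩
      ext z
      simp only [mem_neighborFinset, Finset.mem_singleton]
      exact ⟨fun hz => hM hz hw, fun hz => hz ▸ hw⟩
    · rw [← card_neighborFinset_eq_degree, Finset.card_eq_zero]
      ext z
      simp only [mem_neighborFinset, Finset.notMem_empty, iff_false]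
      exact fun hz => hv ⟨z, hz⟩
  simp only [hd, Finset.sum_boole, Nat.cast_id] at h
  rw [Set.ncard_eq_toFinset_card', Set.ncard_eq_toFinset_card']
  rw [edgeFinset] at h
  rw [← h]
  congr 1
  ext v
  simp

lemma two_mul_matchingNumber_le [Finite V] (G : SimpleGraph V) :
    2 * G.matchingNumber ≤ G.support.ncard := by
  obtain ⟨M, hM, h1, h2⟩ := exists_maxDegOne G
  rw [← h2, h1.two_mul_ncard]
  exact Set.ncard_le_ncard (support_mono hM) (Set.toFinite _)

/-- A matching has at most `|K|` edges outside a subgraph `H` with `G \ H` covered by `K`. -/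
lemma two_mul_matchingNumber_le_of_cover [Finite V] {K : Set V}
    (h : ∀ u v, G.Adj u v → ¬ H.Adj u v → u ∈ K ∨ v ∈ K) :
    2 * G.matchingNumber ≤ 2 * K.ncard + H.support.ncard := by
  have h1 := matchingNumber_le_isolate_add_ncard G K
  have h2 : G.isolate K ≤ H := by
    intro u v huv
    by_contra h'
    exact (h u v huv.1 h').elim huv.2.1 huv.2.2
  have h3 := matchingNumber_mono h2
  have h4 := two_mul_matchingNumber_le H
  omega

lemma matchingNumber_add_le [Finite V] {H₁ H₂ : SimpleGraph V} (h₁ : H₁ ≤ G) (h₂ : H₂ ≤ G)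
    (h : Disjoint H₁.support H₂.support) :
    H₁.matchingNumber + H₂.matchingNumber ≤ G.matchingNumber := by
  obtain ⟨M, hM, h1, h2⟩ := exists_maxDegOne H₁
  obtain ⟨N, hN, h3, h4⟩ := exists_maxDegOne H₂
  have hno : ∀ x a b, M.Adj x a → N.Adj x b → False := fun x a b ha hb =>
    Set.disjoint_left.mp h ⟨a, hM ha⟩ ⟨b, hN hb⟩
  have h5 : (M ⊔ N).MaxDegOne := by
    rintro x a b (ha | ha) (hb | hb)
    · exact h1 ha hb
    · exact (hno _ _ _ ha hb).elim
    · exact (hno _ _ _ hb ha).elim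
    · exact h3 ha hb
  have := h5.ncard_le_matchingNumber (sup_le (hM.trans h₁) (hN.trans h₂))
  rw [edgeSet_sup, Set.ncard_union_eq] at this
  · omega
  · rw [Set.disjoint_left]
    intro e
    induction e with | _ a b =>
    exact fun ha hb => hno _ _ _ ha hb

/-! ### The cyclomatic number under deletion of edges and vertices -/

lemma reachable_deleteEdges_or {u v a b : V} (h : G.Reachable a b) :
    (G.deleteEdges {s(u, v)}).Reachable a b ∨
      (G.deleteEdges {s(u, v)}).Reachable a u ∧ (G.deleteEdges {s(u, v)}).Reachable v b ∨
      (G.deleteEdges {s(u, v)}).Reachable a v ∧ (G.deleteEdges {s(u, v)}).Reachable u b := by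
  obtain ⟨p⟩ := h
  induction p with
  | nil => exact Or.inl (Reachable.refl _)
  | @cons x y z hxy p ih =>
    by_cases he : s(x, y) = s(u, v)
    · rw [Sym2.eq_iff] at he
      have hr : ∀ w, (G.deleteEdges {s(u, v)}).Reachable w w := fun w => Reachable.refl w
      rcases he with ⟨rfl, rfl⟩ | ⟨rfl, rfl⟩ <;> rcases ih with ih | ih | ih
      · exact Or.inr (Or.inl ⟨hr _, ih⟩)
      · exact Or.inr (Or.inl ⟨hr _, ih.2⟩)
      · exact Or.inl ih.2
      · exact Or.inr (Or.inr ⟨hr _, ih⟩)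
      · exact Or.inl ih.2
      · exact Or.inr (Or.inr ⟨hr _, ih.2⟩)
    · have hadj : (G.deleteEdges {s(u, v)}).Adj x y := by
        rw [deleteEdges_adj]; exact ⟨hxy, he⟩
      rcases ih with ih | ih | ih
      · exact Or.inl (hadj.reachable.trans ih)
      · exact Or.inr (Or.inl ⟨hadj.reachable.trans ih.1, ih.2⟩)
      · exact Or.inr (Or.inr ⟨hadj.reachable.trans ih.1, ih.2⟩)

lemma ncard_edgeSet_deleteEdges [Finite V] {u v : V} (h : G.Adj u v) :
    (G.deleteEdges {s(u, v)}).edgeSet.ncard + 1 = G.edgeSet.ncard := by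
  rw [edgeSet_deleteEdges]
  exact Set.ncard_sdiff_singleton_add_one h (Set.toFinite _)

lemma cyclomaticNumber_deleteEdges_of_cyclePart [Finite V] {u v : V} (h : G.cyclePart.Adj u v) :
    G.cyclomaticNumber = (G.deleteEdges {s(u, v)}).cyclomaticNumber + 1 := by
  have hle : G.deleteEdges {s(u, v)} ≤ G := deleteEdges_le _
  have h1 := ncard_edgeSet_deleteEdges h.1
  have h2 : Nat.card (G.deleteEdges {s(u, v)}).ConnectedComponent =
      Nat.card G.ConnectedComponent := by
    refine Nat.card_eq_of_bijective _ ⟨?_, ConnectedComponent.surjective_map_ofLE hle⟩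
    intro C D
    refine ConnectedComponent.ind₂ (fun a b hab => ?_) C D
    simp only [ConnectedComponent.map_mk, ConnectedComponent.eq, Hom.ofLE_apply] at hab ⊢
    rcases reachable_deleteEdges_or (u := u) (v := v) hab with h' | h' | h'
    · exact h'
    · exact h'.1.trans (h.2.trans h'.2)
    · exact h'.1.trans (h.2.symm.trans h'.2)
  unfold cyclomaticNumber
  rw [h2]
  omega

/-- Deleting a bridge loses one edge and gains one component. -/
lemma cyclomaticNumber_deleteEdges_of_not_cyclePart [Finite V] {u v : V} (h : G.Adj u v)
    (hb : ¬ G.cyclePart.Adj u v) :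
    G.cyclomaticNumber = (G.deleteEdges {s(u, v)}).cyclomaticNumber := by
  have hle : G.deleteEdges {s(u, v)} ≤ G := deleteEdges_le _
  have h1 := ncard_edgeSet_deleteEdges h
  set G' := G.deleteEdges {s(u, v)} with hG'
  have hnr : ¬ G'.Reachable u v := fun h' => hb ⟨h, h'⟩
  -- The components of `u` and `v` merge in `G`; leaving out that of `v` makes the map on components
  -- bijective.
  have h2 : Nat.card {C : G'.ConnectedComponent // C ≠ G'.connectedComponentMk v} =
      Nat.card G.ConnectedComponent := by
    refine Nat.card_eq_of_bijective (fun C => C.1.map (Hom.ofLE hle)) ⟨?_, ?_⟩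
    · rintro ⟨C, hC⟩ ⟨D, hD⟩ hCD
      rw [Subtype.mk.injEq]
      revert hC hD hCD
      refine ConnectedComponent.ind₂ (fun a b hC hD hab => ?_) C D
      simp only [ConnectedComponent.map_mk, ConnectedComponent.eq, Hom.ofLE_apply, ne_eq]
        at hab hC hD ⊢
      rcases reachable_deleteEdges_or (u := u) (v := v) hab with h' | h' | h'
      · exact h'
      · exact absurd h'.2.symm hD
      · exact absurd h'.1 hC
    · refine ConnectedComponent.ind fun a => ?_
      by_cases ha : G'.connectedComponentMk a = G'.connectedComponentMk v
      · refine ⟨⟨G'.connectedComponentMk u, fun h' => hnr (ConnectedComponent.exact h')⟩, ?_⟩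
        simp only [ConnectedComponent.map_mk, ConnectedComponent.eq, Hom.ofLE_apply] at ha ⊢
        exact h.reachable.trans (ha.mono hle).symm
      · exact ⟨⟨_, ha⟩, rfl⟩
  have h3 : Nat.card {C : G'.ConnectedComponent // C ≠ G'.connectedComponentMk v} + 1 =
      Nat.card G'.ConnectedComponent := by
    have := Set.ncard_sdiff_singleton_add_one (Set.mem_univ (G'.connectedComponentMk v))
      (Set.toFinite _)
    rw [Set.ncard_univ] at this
    rwa [show Set.univ \ {G'.connectedComponentMk v} = {C | C ≠ G'.connectedComponentMk v} by
      ext C; simp, ← Nat.card_coe_set_eq] at this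
  unfold cyclomaticNumber
  omega

/-- Induction over the edges that are removed when passing from a graph to a subgraph. -/
lemma deleteEdges_induction [Finite V] {P : SimpleGraph V → Prop} (h : H ≤ G) (hG : P G)
    (step : ∀ K, H ≤ K → K ≤ G → ∀ u v, K.Adj u v → ¬ H.Adj u v → P K →
      P (K.deleteEdges {s(u, v)})) : P H := by
  suffices ∀ n, ∀ K, H ≤ K → K ≤ G → P K → K.edgeSet.ncard = n → P H from
    this _ G h le_rfl hG rfl
  intro n
  induction n with
  | zero =>
    intro K h1 h2 h3 h4
    have : K = ⊥ := by
      rw [Set.ncard_eq_zero (Set.toFinite _)] at h4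
      exact edgeSet_eq_empty.mp h4
    rwa [le_antisymm h1 (this ▸ bot_le)]
  | succ n ih =>
    intro K h1 h2 h3 h4
    by_cases hK : K ≤ H
    · rwa [le_antisymm h1 hK]
    · obtain ⟨u, v, huv, hn⟩ : ∃ u v, K.Adj u v ∧ ¬ H.Adj u v := by
        by_contra! hc
        exact hK fun u v huv => hc u v huv
      refine ih (K.deleteEdges {s(u, v)}) ?_ ((deleteEdges_le _).trans h2)
        (step K h1 h2 u v huv hn h3) ?_
      · intro a b hab
        rw [deleteEdges_adj]
        refine ⟨h1 hab, fun he => hn ?_⟩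
        rw [Set.mem_singleton_iff] at he
        exact (H.mem_edgeSet).mp (he ▸ (H.mem_edgeSet).mpr hab)
      · have := ncard_edgeSet_deleteEdges huv
        omega

lemma cyclomaticNumber_deleteEdges_le [Finite V] {u v : V} (h : G.Adj u v) :
    (G.deleteEdges {s(u, v)}).cyclomaticNumber ≤ G.cyclomaticNumber := by
  by_cases hb : G.cyclePart.Adj u v
  · rw [cyclomaticNumber_deleteEdges_of_cyclePart hb]; omega
  · rw [cyclomaticNumber_deleteEdges_of_not_cyclePart h hb]

lemma cyclomaticNumber_mono [Finite V] (h : H ≤ G) :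
    H.cyclomaticNumber ≤ G.cyclomaticNumber := by
  refine deleteEdges_induction (P := fun K => K.cyclomaticNumber ≤ G.cyclomaticNumber) h le_rfl ?_
  intro K _ _ u v huv _ hK
  exact (cyclomaticNumber_deleteEdges_le huv).trans hK

@[simp] lemma cyclomaticNumber_bot [Finite V] : (⊥ : SimpleGraph V).cyclomaticNumber = 0 := by
  have : Nat.card (⊥ : SimpleGraph V).ConnectedComponent = Nat.card V := by
    refine (Nat.card_eq_of_bijective (⊥ : SimpleGraph V).connectedComponentMk ⟨?_, ?_⟩).symm
    · intro a b hab
      exact reachable_bot.mp (ConnectedComponent.exact hab)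
    · exact ConnectedComponent.ind fun a => ⟨a, rfl⟩
  simp [cyclomaticNumber, this]

lemma cyclomaticNumber_nonneg [Finite V] (G : SimpleGraph V) : 0 ≤ G.cyclomaticNumber := by
  rw [← cyclomaticNumber_bot (V := V)]
  exact cyclomaticNumber_mono bot_le

/-- Deleting edges that lie on no cycle preserves the cyclomatic number. -/
lemma cyclomaticNumber_eq_of_cyclePart_le [Finite V] (h : H ≤ G) (hc : G.cyclePart ≤ H) :
    G.cyclomaticNumber = H.cyclomaticNumber := by
  refine deleteEdges_induction (P := fun K => G.cyclomaticNumber = K.cyclomaticNumber) h rfl ?_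
  intro K _ hKG u v huv hn hK
  rw [hK]
  exact cyclomaticNumber_deleteEdges_of_not_cyclePart huv fun h' => hn (hc (cyclePart_mono hKG h'))

lemma isolate_le_deleteEdges {X : Set V} {x y : V} (hx : x ∈ X) :
    G.isolate X ≤ G.deleteEdges {s(x, y)} := by
  intro a b hab
  rw [deleteEdges_adj]
  refine ⟨hab.1, fun he => ?_⟩
  rw [Set.mem_singleton_iff, Sym2.eq_iff] at he
  rcases he with ⟨rfl, -⟩ | ⟨-, rfl⟩
  · exact hab.2.1 hx
  · exact hab.2.2 hx

lemma cyclomaticNumber_isolate_lt [Finite V] {x : V} (hx : x ∈ G.cyclePart.support) :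
    (G.isolate {x}).cyclomaticNumber + 1 ≤ G.cyclomaticNumber := by
  obtain ⟨y, hy⟩ := hx
  rw [cyclomaticNumber_deleteEdges_of_cyclePart hy]
  have := cyclomaticNumber_mono (G.isolate_le_deleteEdges (y := y) (Set.mem_singleton x))
  omega

/-- The vertex `z` is the other neighbour of `x` on a cycle through `x y`; the rest of that cycle
joins `y` to `z` without using `x`. -/
lemma exists_reachable_isolate_of_cyclePart_adj {x y : V} (h : G.cyclePart.Adj x y) :
    ∃ z, z ≠ y ∧ G.Adj x z ∧ (G.isolate {x}).Reachable y z := by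
  obtain ⟨n, c, hc, rfl, rfl⟩ := exists_isCyclicSeq_of_cyclePart_adj h
  have h3 := hc.three_le
  refine ⟨c (0 + (n - 1)), (hc.succ_ne_pred 0).symm, hc.adj_pred 0, ?_⟩
  have : c (0 + (n - 1)) = c (1 + (n - 2)) := by congr 1; omega
  rw [this]
  refine IsCyclicSeq.reachable_arc 1 (n - 2) fun j h1 h2 => ⟨hc.adj j, fun h' => ?_, fun h' => ?_⟩
  · have := hc.eq_of_lt (by omega) (by omega) h'
    omega
  · have := hc.eq_of_lt (by omega) (by omega) h'
    omega

/-- If deleting a vertex of any cycle lowers the cyclomatic number by only one, then every vertex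
lies on at most one cycle. -/
lemma maxDegTwo_cyclePart [Finite V]
    (h : ∀ x ∈ G.cyclePart.support,
      G.cyclomaticNumber ≤ (G.isolate {x}).cyclomaticNumber + 1) : G.cyclePart.MaxDegTwo := by
  intro x a b d ha hb hd
  by_contra! hne
  obtain ⟨a', ha', hxa', hr⟩ := exists_reachable_isolate_of_cyclePart_adj ha
  -- A cycle through `x a` returns to `x` by `a'`. Among three neighbours one, `e`, is neither `a`
  -- nor `a'`. Removing `x e` lowers the cyclomatic number and keeps that cycle; removing `x a` then
  -- lowers it again. What remains contains `G.isolate {x}`, so isolating `x` costs at least 2.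
  obtain ⟨e, hea, hea', he⟩ : ∃ e, e ≠ a ∧ e ≠ a' ∧ G.cyclePart.Adj x e := by
    by_cases hba : b = a'
    · exact ⟨d, hne.2.1.symm, fun h' => hne.2.2 (hba.trans h'.symm), hd⟩
    · exact ⟨b, hne.1.symm, hba, hb⟩
  have h1 := cyclomaticNumber_deleteEdges_of_cyclePart he
  set G' := G.deleteEdges {s(x, e)} with hG'
  have hG'x : G.isolate {x} ≤ G' := G.isolate_le_deleteEdges (Set.mem_singleton x)
  have hG'' : G.isolate {x} ≤ G'.deleteEdges {s(x, a)} := by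
    have h4 : (G.isolate {x}).isolate {x} = G.isolate {x} := by
      rw [isolate_isolate, Set.union_self]
    rw [← h4]
    exact (isolate_mono hG'x _).trans (G'.isolate_le_deleteEdges (Set.mem_singleton x))
  have hadj : ∀ z, G.Adj x z → z ≠ e → G'.Adj x z := by
    intro z hz hze
    rw [hG', deleteEdges_adj]
    refine ⟨hz, fun h' => ?_⟩
    rw [Set.mem_singleton_iff, Sym2.eq_iff] at h'
    rcases h' with h' | h'
    · exact hze h'.2
    · exact hz.ne h'.2.symm
  have h2 : G'.cyclePart.Adj x a := by
    refine ⟨hadj a ha.1 hea.symm, ?_⟩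
    have h5 : (G'.deleteEdges {s(x, a)}).Adj x a' := by
      rw [deleteEdges_adj]
      refine ⟨hadj a' hxa' hea'.symm, fun h' => ?_⟩
      rw [Set.mem_singleton_iff, Sym2.eq_iff] at h'
      rcases h' with h' | h'
      · exact ha' h'.2
      · exact hxa'.ne h'.2.symm
    exact h5.reachable.trans (hr.mono hG'').symm
  have h3 := cyclomaticNumber_deleteEdges_of_cyclePart h2
  have h4 := cyclomaticNumber_mono hG''
  have := h x ⟨a, ha⟩
  omega

/-! ### End blocks: pendant vertices and cycles attached by at most one edge -/

/-- At most one edge of `G` leaves `S`. -/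
def BoundaryLeOne (G : SimpleGraph V) (S : Set V) : Prop :=
  ∀ ⦃a a' b b' : V⦄, a ∈ S → a' ∈ S → b ∉ S → b' ∉ S → G.Adj a b → G.Adj a' b' → a = a' ∧ b = b'

/-- The edges inside a minimal set with at most one leaving edge are not bridges. -/
lemma cyclePart_adj_of_minimal {S₀ S : Set V}
    (hS : Minimal (fun S : Set V => S.Nonempty ∧ S ⊆ S₀ ∧ G.BoundaryLeOne S) S) {a b : V}
    (ha : a ∈ S) (hb : b ∈ S) (hab : G.Adj a b) : G.cyclePart.Adj a b := by
  by_contra hn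
  obtain ⟨⟨-, hSS, hbd⟩, hmin⟩ := hS
  have hmin' : ∀ T : Set V, T ⊆ S → T.Nonempty → G.BoundaryLeOne T → S ⊆ T :=
    fun T hT h1 h2 => hmin ⟨h1, hT.trans hSS, h2⟩ hT
  set K := (G.isolate Sᶜ).deleteEdges {s(a, b)} with hK
  have hnr : ¬ K.Reachable a b := fun h => hn ⟨hab, h.mono (deleteEdges_mono (isolate_le _))⟩
  have hadj : ∀ x y, x ∈ S → y ∈ S → G.Adj x y → K.Reachable a x → ¬ K.Reachable a y →
      x = a ∧ y = b := by
    intro x y hx hy hxy hax hay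
    by_cases he : s(x, y) = s(a, b)
    · rw [Sym2.eq_iff] at he
      rcases he with he | he
      · exact he
      · exact absurd (he.1 ▸ hax) hnr
    · have : K.Adj x y := by
        rw [hK, deleteEdges_adj]
        exact ⟨⟨hxy, by simpa using hx, by simpa using hy⟩, he⟩
      exact absurd (hax.trans this.reachable) hay
  set A : Set V := {z | z ∈ S ∧ K.Reachable a z} with hA
  set B : Set V := {z | z ∈ S ∧ ¬ K.Reachable a z} with hB
  have hAne : A.Nonempty := ⟨a, ha, Reachable.refl _⟩
  have hBne : B.Nonempty := ⟨b, hb, hnr⟩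
  -- If `a b` were a bridge, it would be the only edge between the parts `A` and `B` of `S`. The
  -- single edge that may leave `S` starts in at most one part, so the other part has only `a b` on
  -- its boundary, against minimality.
  by_cases hout : ∃ x ∈ A, ∃ y, y ∉ S ∧ G.Adj x y
  · obtain ⟨x, hx, y, hy, hxy⟩ := hout
    have hBout : ∀ z ∈ B, ∀ t, t ∉ B → G.Adj z t → z = b ∧ t = a := by
      intro z hz t ht hzt
      by_cases htS : t ∈ S
      · have htA : K.Reachable a t := by
          by_contra h'
          exact ht ⟨htS, h'⟩
        exact (hadj t z htS hz.1 hzt.symm htA hz.2).symm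
      · exact absurd ((hbd hx.1 hz.1 hy htS hxy hzt).1 ▸ hx.2) hz.2
    refine (hmin' B (fun z hz => hz.1) hBne ?_ ha).2 (Reachable.refl _)
    intro z z' t t' hz hz' ht ht' h1 h2
    obtain ⟨rfl, rfl⟩ := hBout z hz t ht h1
    obtain ⟨rfl, rfl⟩ := hBout z' hz' t' ht' h2
    exact ⟨rfl, rfl⟩
  · have hAout : ∀ z ∈ A, ∀ t, t ∉ A → G.Adj z t → z = a ∧ t = b := by
      intro z hz t ht hzt
      have htS : t ∈ S := by
        by_contra htS
        exact hout ⟨z, hz, t, htS, hzt⟩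
      exact hadj z t hz.1 htS hzt hz.2 fun h' => ht ⟨htS, h'⟩
    refine hnr (hmin' A (fun z hz => hz.1) hAne ?_ hb).2
    intro z z' t t' hz hz' ht ht' h1 h2
    obtain ⟨rfl, rfl⟩ := hAout z hz t ht h1
    obtain ⟨rfl, rfl⟩ := hAout z' hz' t' ht' h2
    exact ⟨rfl, rfl⟩

/-- A non-bridge leaving `S` would be the only edge leaving `S`, yet the walk bypassing it must also
leave `S`. -/
lemma BoundaryLeOne.mem_of_cyclePart_adj {S : Set V} (hS : G.BoundaryLeOne S) {a b : V}
    (ha : a ∈ S) (hab : G.cyclePart.Adj a b) : b ∈ S := by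
  by_contra hb
  obtain ⟨p⟩ := hab.2
  have key : ∀ x y (p : (G.deleteEdges {s(a, b)}).Walk x y), x ∈ S → y ∈ S := by
    intro x y p
    induction p with
    | nil => exact id
    | @cons x y z hxy p ih =>
      intro hx
      refine ih ?_
      by_contra hy
      rw [deleteEdges_adj] at hxy
      obtain ⟨rfl, rfl⟩ := hS ha hx hb hy hab.1 hxy.1
      exact hxy.2 rfl
  exact hb (key _ _ p ha)

/-- A graph whose cycles are vertex-disjoint has, in every set of non-isolated vertices that at
most one edge leaves, a pendant vertex or a cycle that at most one edge leaves. -/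
lemma exists_pendant_or_cycle [Finite V] (h2 : G.cyclePart.MaxDegTwo) {S₀ : Set V}
    (hne : S₀.Nonempty) (hs : S₀ ⊆ G.support) (hb : G.BoundaryLeOne S₀) :
    (∃ u ∈ S₀, ∃ w, G.Adj u w ∧ ∀ z, G.Adj u z → z = w) ∨
      ∃ n c, G.IsCyclicSeq n c ∧ Set.range c ⊆ S₀ ∧ G.BoundaryLeOne (Set.range c) ∧
        ∀ y ∈ Set.range c, ∀ z ∈ Set.range c, G.Adj y z → G.cyclePart.Adj y z := by
  obtain ⟨S, -, hS⟩ := exists_minimal_le_of_wellFoundedLT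
    (fun S : Set V => S.Nonempty ∧ S ⊆ S₀ ∧ G.BoundaryLeOne S) S₀ ⟨hne, le_rfl, hb⟩
  have hin := fun a ha b hb => cyclePart_adj_of_minimal hS (a := a) (b := b) ha hb
  obtain ⟨⟨⟨u, hu⟩, hSS, hbd⟩, -⟩ := hS
  -- An inner edge of the minimal set lies on a cycle, which stays inside `S`. By the degree bound,
  -- every edge leaving that cycle leaves `S`, so there is at most one. Without inner edges, all
  -- edges at a vertex of `S` leave `S`, so it is pendant.
  by_cases hex : ∃ a ∈ S, ∃ b ∈ S, G.Adj a b
  · obtain ⟨a, ha, b, hb', hab⟩ := hex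
    obtain ⟨n, c, hc, rfl, rfl⟩ := exists_isCyclicSeq_of_cyclePart_adj (hin a ha b hb' hab)
    have hcS : ∀ i, c i ∈ S := by
      intro i
      induction i with
      | zero => exact ha
      | succ i ih => exact hbd.mem_of_cyclePart_adj ih (hc.cyclePart.adj i)
    refine Or.inr ⟨n, c, hc, ?_, ?_, ?_⟩
    · rintro _ ⟨i, rfl⟩
      exact hSS (hcS i)
    · have hout : ∀ z ∈ Set.range c, ∀ t, t ∉ Set.range c → G.Adj z t → t ∉ S := by
        rintro _ ⟨i, rfl⟩ t ht hzt htS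
        exact ht (hc.cyclePart.mem_range_of_adj h2 ⟨i, rfl⟩ (hin _ (hcS i) _ htS hzt))
      intro z z' t t' hz hz' ht ht' e1 e2
      refine hbd ?_ ?_ (hout z hz t ht e1) (hout z' hz' t' ht' e2) e1 e2
      · obtain ⟨i, rfl⟩ := hz; exact hcS i
      · obtain ⟨i, rfl⟩ := hz'; exact hcS i
    · rintro _ ⟨i, rfl⟩ _ ⟨j, rfl⟩ hij
      exact hin _ (hcS i) _ (hcS j) hij
  · obtain ⟨w, hw⟩ := hs (hSS hu)
    have hout : ∀ z, G.Adj u z → z ∉ S := fun z hz hzS => hex ⟨u, hu, z, hzS, hz⟩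
    exact Or.inl ⟨u, hSS hu, w, hw, fun z hz => (hbd hu hu (hout z hz) (hout w hw) hz hw).2⟩

lemma boundaryLeOne_support : G.BoundaryLeOne G.support :=
  fun _ _ _ _ _ _ hb _ h1 _ => absurd ⟨_, h1.symm⟩ hb

lemma support_nonempty_iff : G.support.Nonempty ↔ G ≠ ⊥ := by
  rw [Set.nonempty_iff_ne_empty, ne_eq, ne_eq, not_iff_not]
  constructor
  · intro h
    ext u v
    simp only [bot_adj, iff_false]
    intro h'
    have : u ∈ G.support := ⟨v, h'⟩
    rw [h] at this
    exact this
  · rintro rfl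
    ext u
    simp

/-- A vertex cover of a forest with as many vertices as a maximum matching has edges. -/
lemma exists_cover_of_cyclePart_eq_bot [Finite V] (h : G.cyclePart = ⊥) :
    ∃ K : Set V, (∀ u v, G.Adj u v → u ∈ K ∨ v ∈ K) ∧ K.ncard ≤ G.matchingNumber := by
  induction hn : G.edgeSet.ncard using Nat.strong_induction_on generalizing G with
  | _ n ih =>
  by_cases hG : G = ⊥
  · subst hG
    exact ⟨∅, by simp, by simp⟩
  have h2 : G.cyclePart.MaxDegTwo := by
    rw [h]
    exact fun _ _ _ _ h' => h'.elim
  rcases exists_pendant_or_cycle h2 (support_nonempty_iff.mpr hG) le_rfl boundaryLeOne_support with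
    ⟨u, -, w, hw, hu⟩ | ⟨n, c, hc, -⟩
  · have hlt := ncard_edgeSet_isolate_lt (Set.mem_singleton w) hw.symm
    obtain ⟨K, hK, hcard⟩ := ih _ (hn ▸ hlt)
      (le_bot_iff.mp (h ▸ cyclePart_mono (isolate_le {w}))) rfl
    -- The neighbour `w` of a pendant vertex joins the cover, and the pendant edge pays for it in
    -- the matching.
    refine ⟨insert w K, fun a b hab => ?_, ?_⟩
    · by_cases ha : a = w
      · exact Or.inl (ha ▸ Set.mem_insert _ _)
      by_cases hb : b = w
      · exact Or.inr (hb ▸ Set.mem_insert _ _)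
      exact (hK a b ⟨hab, ha, hb⟩).imp (Set.mem_insert_of_mem _) (Set.mem_insert_of_mem _)
    · have h3 := matchingNumber_isolate_add_le (isolate_le {w}) hw
        (fun z hz => hz.2.2 (hu z hz.1)) (fun z hz => hz.2.1 rfl)
      have := Set.ncard_insert_le w K
      omega
  · have := hc.cyclePart.adj 0
    rw [h] at this
    exact this.elim

end SimpleGraph

/-! ### The positive index of a Hermitian form -/

namespace Matrix

variable {V : Type*} [Fintype V]

/-- The Hermitian form of `A`. -/
noncomputable def hermForm (A : Matrix V V ℂ) (f : V → ℂ) : ℝ := (star f ⬝ᵥ (A *ᵥ f)).re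

/-- The largest dimension of a subspace on which the Hermitian form of `A` is positive definite. -/
noncomputable def posIndex (A : Matrix V V ℂ) : ℕ :=
  sSup {d | ∃ W : Submodule ℂ (V → ℂ), Module.finrank ℂ W = d ∧ ∀ f ∈ W, f ≠ 0 → 0 < A.hermForm f}

lemma bddAbove_posIndex (A : Matrix V V ℂ) : BddAbove
    {d | ∃ W : Submodule ℂ (V → ℂ), Module.finrank ℂ W = d ∧ ∀ f ∈ W, f ≠ 0 → 0 < A.hermForm f} := by
  refine ⟨Module.finrank ℂ (V → ℂ), ?_⟩
  rintro _ ⟨W, rfl, -⟩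
  exact Submodule.finrank_le W

lemma exists_finrank_eq_posIndex (A : Matrix V V ℂ) : ∃ W : Submodule ℂ (V → ℂ),
    Module.finrank ℂ W = A.posIndex ∧ ∀ f ∈ W, f ≠ 0 → 0 < A.hermForm f :=
  Nat.sSup_mem (s := {d | ∃ W : Submodule ℂ (V → ℂ), Module.finrank ℂ W = d ∧
    ∀ f ∈ W, f ≠ 0 → 0 < A.hermForm f}) ⟨0, ⊥, by simp, by simp⟩ A.bddAbove_posIndex

@[simp] lemma hermForm_zero (A : Matrix V V ℂ) : A.hermForm 0 = 0 := by simp [hermForm]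

/-- Positivity of the pulled-back form already makes `T` injective, so its range has full dimension.
-/
lemma finrank_le_posIndex {E : Type*} [AddCommGroup E] [Module ℂ E] {A : Matrix V V ℂ}
    (T : E →ₗ[ℂ] V → ℂ) (h : ∀ g, g ≠ 0 → 0 < A.hermForm (T g)) :
    Module.finrank ℂ E ≤ A.posIndex := by
  have hinj : Function.Injective T := by
    rw [← LinearMap.ker_eq_bot, LinearMap.ker_eq_bot']
    intro g hg
    by_contra hne
    have := h g hne
    simp [hg] at this
  refine le_csSup A.bddAbove_posIndex ⟨LinearMap.range T, LinearMap.finrank_range_of_inj hinj, ?_⟩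
  rintro _ ⟨g, rfl⟩ hne
  exact h g fun hg => hne (by simp [hg])

lemma posIndex_le_of_linearMap {A B : Matrix V V ℂ} (T : (V → ℂ) →ₗ[ℂ] V → ℂ)
    (h : ∀ f, B.hermForm f = A.hermForm (T f)) : B.posIndex ≤ A.posIndex := by
  obtain ⟨W, hW, hpos⟩ := exists_finrank_eq_posIndex B
  rw [← hW]
  refine finrank_le_posIndex (T.comp W.subtype) fun g hg => ?_
  have := hpos g g.2 (by simpa using hg)
  rwa [h] at this

lemma hermForm_add {A : Matrix V V ℂ} (hA : A.IsHermitian) (f g : V → ℂ) :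
    A.hermForm (f + g) = A.hermForm f + A.hermForm g + 2 * (star g ⬝ᵥ (A *ᵥ f)).re := by
  have h : (star f ⬝ᵥ (A *ᵥ g)).re = (star g ⬝ᵥ (A *ᵥ f)).re := by
    have : star f ⬝ᵥ (A *ᵥ g) = star (star g ⬝ᵥ (A *ᵥ f)) := by
      rw [star_dotProduct, star_mulVec, hA.eq, ← dotProduct_mulVec]
    rw [this]
    simp
  simp only [hermForm, star_add, mulVec_add, add_dotProduct, dotProduct_add, Complex.add_re]
  rw [h]
  ring

variable [DecidableEq V]

lemma IsHermitian.hermForm_eq_sum {A : Matrix V V ℂ} (hA : A.IsHermitian) (f : V → ℂ) :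
    A.hermForm f = ∑ i, hA.eigenvalues i *
      Complex.normSq (((hA.eigenvectorUnitary : Matrix V V ℂ)ᴴ *ᵥ f) i) := by
  have h := hA.spectral_theorem
  rw [Unitary.conjStarAlgAut_apply] at h
  set U : Matrix V V ℂ := (hA.eigenvectorUnitary : Matrix V V ℂ) with hU
  have : star f ⬝ᵥ (A *ᵥ f) =
      star (Uᴴ *ᵥ f) ⬝ᵥ (diagonal (RCLike.ofReal ∘ hA.eigenvalues) *ᵥ (Uᴴ *ᵥ f)) := by
    conv_lhs => rw [h]
    rw [star_mulVec, conjTranspose_conjTranspose, ← dotProduct_mulVec, mulVec_mulVec, mulVec_mulVec]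
    rfl
  rw [hermForm, this]
  simp only [dotProduct, mulVec_diagonal, Complex.re_sum]
  refine Finset.sum_congr rfl fun i _ => ?_
  simp [Complex.normSq_apply]
  ring

/-- Sylvester's law of inertia. A positive definite subspace projects injectively to the positive
eigenspaces, since the form is nonpositive on the kernel of that projection; conversely, the
eigenvectors of positive eigenvalues span a positive definite subspace. -/
theorem IsHermitian.posIndex_eq {A : Matrix V V ℂ} (hA : A.IsHermitian) :
    A.posIndex = Nat.card {i // 0 < hA.eigenvalues i} := by
  classical
  set U : Matrix V V ℂ := (hA.eigenvectorUnitary : Matrix V V ℂ) with hU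
  have hUU : Uᴴ * U = 1 := by
    have := Unitary.coe_star_mul_self hA.eigenvectorUnitary
    exact this
  have hUU' : U * Uᴴ = 1 := by
    have := Unitary.coe_mul_star_self hA.eigenvectorUnitary
    exact this
  have hcard : Nat.card {i // 0 < hA.eigenvalues i} =
      Module.finrank ℂ ({i // 0 < hA.eigenvalues i} → ℂ) := by
    rw [Module.finrank_fintype_fun_eq_card, Nat.card_eq_fintype_card]
  rw [hcard]
  apply le_antisymm
  · obtain ⟨W, hW, hpos⟩ := exists_finrank_eq_posIndex A
    rw [← hW]
    let T : W →ₗ[ℂ] ({i // 0 < hA.eigenvalues i} → ℂ) :=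
      (LinearMap.funLeft ℂ ℂ Subtype.val).comp ((mulVecLin Uᴴ).comp W.subtype)
    refine LinearMap.finrank_le_finrank_of_injective (f := T) ?_
    rw [← LinearMap.ker_eq_bot, LinearMap.ker_eq_bot']
    intro g hg
    by_contra hne
    have h1 := hpos g g.2 (by simpa using hne)
    rw [hA.hermForm_eq_sum] at h1
    refine absurd h1 (not_lt.mpr (Finset.sum_nonpos fun i _ => ?_))
    by_cases hi : 0 < hA.eigenvalues i
    · have : (Uᴴ *ᵥ (g : V → ℂ)) i = 0 := congrFun hg ⟨i, hi⟩
      rw [← hU, this]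
      simp
    · exact mul_nonpos_of_nonpos_of_nonneg (not_lt.mp hi) (Complex.normSq_nonneg _)
  · let T : ({i // 0 < hA.eigenvalues i} → ℂ) →ₗ[ℂ] V → ℂ :=
      (mulVecLin U).comp (LinearMap.pi fun i =>
        if h : 0 < hA.eigenvalues i then LinearMap.proj ⟨i, h⟩ else 0)
    refine finrank_le_posIndex T fun g hg => ?_
    rw [hA.hermForm_eq_sum]
    have h1 : ∀ i, (Uᴴ *ᵥ T g) i = if h : 0 < hA.eigenvalues i then g ⟨i, h⟩ else 0 := by
      intro i
      simp only [T, LinearMap.comp_apply, mulVecLin_apply, mulVec_mulVec, hUU, one_mulVec,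
        LinearMap.pi_apply]
      split_ifs <;> rfl
    obtain ⟨⟨j, hj⟩, hgj⟩ := Function.ne_iff.mp hg
    rw [← hU]
    refine Finset.sum_pos' (fun i _ => ?_) ⟨j, Finset.mem_univ _, ?_⟩
    · rw [h1]
      split_ifs with h
      · exact mul_nonneg h.le (Complex.normSq_nonneg _)
      · simp
    · rw [h1, dif_pos hj]
      exact mul_pos hj (Complex.normSq_pos.mpr hgj)

end Matrix

/-! ### The index of a weighted graph under vertex deletion -/

/-- A Hermitian family of complex units, indexed by all ordered pairs of vertices. -/
structure UnitWeight (V : Type*) where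
  /-- The weight of an ordered pair. -/
  toFun : V → V → ℂ
  star_toFun : ∀ u v, star (toFun u v) = toFun v u
  mul_toFun : ∀ u v, toFun u v * toFun v u = 1

namespace UnitWeight

open SimpleGraph Matrix

variable {V : Type*} (a : UnitWeight V) {G H : SimpleGraph V}

open Classical in
/-- The adjacency matrix of `G` with entries weighted by `a`. -/
noncomputable def adjMat (G : SimpleGraph V) : Matrix V V ℂ :=
  Matrix.of fun i j => if G.Adj i j then a.toFun i j else 0

lemma adjMat_of_adj {i j : V} (h : G.Adj i j) : a.adjMat G i j = a.toFun i j := by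
  simp [adjMat, h]

lemma adjMat_of_not_adj {i j : V} (h : ¬ G.Adj i j) : a.adjMat G i j = 0 := by
  simp [adjMat, h]

lemma isHermitian_adjMat (G : SimpleGraph V) : (a.adjMat G).IsHermitian := by
  ext i j
  rw [conjTranspose_apply]
  by_cases h : G.Adj i j
  · rw [a.adjMat_of_adj h, a.adjMat_of_adj h.symm, a.star_toFun]
  · rw [a.adjMat_of_not_adj h, a.adjMat_of_not_adj fun h' => h h'.symm, star_zero]

open Classical in
/-- The projection that kills the coordinates in `X`. -/
noncomputable def kill (X : Set V) : (V → ℂ) →ₗ[ℂ] V → ℂ :=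
  LinearMap.pi fun i => if i ∈ X then 0 else LinearMap.proj i

lemma kill_of_mem {X : Set V} {i : V} (h : i ∈ X) (f : V → ℂ) : kill X f i = 0 := by
  simp [kill, h]

lemma kill_of_notMem {X : Set V} {i : V} (h : i ∉ X) (f : V → ℂ) : kill X f i = f i := by
  simp [kill, h]

variable [Fintype V]

/-- The positive inertia index of `G` with edges weighted by `a`. -/
noncomputable def index (G : SimpleGraph V) : ℕ := (a.adjMat G).posIndex

lemma hermForm_eq (A : Matrix V V ℂ) (f : V → ℂ) :
    A.hermForm f = (∑ i, ∑ j, star (f i) * (A i j * f j)).re := by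
  simp [hermForm, dotProduct, mulVec, Finset.mul_sum]

lemma hermForm_isolate (X : Set V) {f g : V → ℂ} (hg : ∀ i ∈ X, g i = 0)
    (hfg : ∀ i, i ∉ X → f i = g i) :
    (a.adjMat (G.isolate X)).hermForm f = (a.adjMat G).hermForm g := by
  rw [hermForm_eq, hermForm_eq]
  congr 1
  refine Finset.sum_congr rfl fun i _ => Finset.sum_congr rfl fun j _ => ?_
  by_cases hi : i ∈ X
  · rw [hg i hi, a.adjMat_of_not_adj (G := G.isolate X) fun h => h.2.1 hi]
    simp
  by_cases hj : j ∈ X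
  · rw [hg j hj, a.adjMat_of_not_adj (G := G.isolate X) fun h => h.2.2 hj]
    simp
  rw [hfg i hi, hfg j hj]
  by_cases h : G.Adj i j
  · rw [a.adjMat_of_adj h, a.adjMat_of_adj (G := G.isolate X) ⟨h, hi, hj⟩]
  · rw [a.adjMat_of_not_adj h, a.adjMat_of_not_adj (G := G.isolate X) fun h' => h h'.1]

lemma hermForm_kill (X : Set V) (f : V → ℂ) :
    (a.adjMat (G.isolate X)).hermForm f = (a.adjMat G).hermForm (kill X f) :=
  a.hermForm_isolate X (fun _ hi => kill_of_mem hi f) fun _ hi => (kill_of_notMem hi f).symm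

lemma index_isolate_le (G : SimpleGraph V) (X : Set V) : a.index (G.isolate X) ≤ a.index G :=
  posIndex_le_of_linearMap (kill X) (a.hermForm_kill X)

/-- Vanishing at `x` cuts the dimension of a positive definite subspace by at most 1, and on such
vectors the two forms agree. -/
lemma index_le_isolate_add_one (G : SimpleGraph V) (x : V) :
    a.index G ≤ a.index (G.isolate {x}) + 1 := by
  obtain ⟨W, hW, hpos⟩ := exists_finrank_eq_posIndex (a.adjMat G)
  rw [index, ← hW]
  let φ : W →ₗ[ℂ] ℂ := (LinearMap.proj x).comp W.subtype
  have h1 := φ.finrank_range_add_finrank_ker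
  have h2 : Module.finrank ℂ (LinearMap.range φ) ≤ 1 := by
    simpa using Submodule.finrank_le (LinearMap.range φ)
  have h3 : Module.finrank ℂ (LinearMap.ker φ) ≤ a.index (G.isolate {x}) := by
    let T : LinearMap.ker φ →ₗ[ℂ] V → ℂ := W.subtype.comp (LinearMap.ker φ).subtype
    refine finrank_le_posIndex (E := LinearMap.ker φ) T fun g hg => ?_
    have hgx : (g : W).1 x = 0 := g.2
    have := hpos (g : W).1 (g : W).2 (by simpa using hg)
    rwa [← a.hermForm_isolate {x} (f := (g : W).1) (by simpa using hgx) fun _ _ => rfl] at this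
  omega

lemma index_le_isolate_add_ncard (G : SimpleGraph V) (K : Set V) :
    a.index G ≤ a.index (G.isolate K) + K.ncard := by
  induction K, K.toFinite using Set.Finite.induction_on with
  | empty => simp [isolate_empty]
  | @insert x s hx hs ih =>
    rw [Set.ncard_insert_of_notMem hx hs]
    have := a.index_le_isolate_add_one (G.isolate s) x
    rw [isolate_isolate, Set.union_singleton] at this
    omega

@[simp] lemma index_bot : a.index (⊥ : SimpleGraph V) = 0 := by
  obtain ⟨W, hW, hpos⟩ := exists_finrank_eq_posIndex (a.adjMat ⊥)
  rw [index, ← hW, Submodule.finrank_eq_zero, Submodule.eq_bot_iff]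
  intro f hf
  by_contra hne
  have := hpos f hf hne
  have h0 : a.adjMat (⊥ : SimpleGraph V) = 0 := by
    ext i j
    exact a.adjMat_of_not_adj id
  simp [hermForm, h0] at this

/-- Deleting a vertex on which some null vector does not vanish preserves the index. -/
lemma index_le_isolate_of_mulVec_eq_zero {w : V → ℂ} (hw : a.adjMat G *ᵥ w = 0) {x : V}
    (hx : w x ≠ 0) : a.index G ≤ a.index (G.isolate {x}) := by
  have hA := a.isHermitian_adjMat G
  -- Subtracting the multiple of `w` that clears the coordinate `x` does not change the form,
  -- because `w` is in its radical.
  refine posIndex_le_of_linearMap (LinearMap.id - (LinearMap.proj x).smulRight ((w x)⁻¹ • w))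
    fun f => ?_
  set g := (LinearMap.id - (LinearMap.proj x).smulRight ((w x)⁻¹ • w) : (V → ℂ) →ₗ[ℂ] V → ℂ) f
    with hg
  have hg' : g = f + (-(f x * (w x)⁻¹)) • w := by
    ext i
    simp [hg]
    ring
  have hgx : g x = 0 := by
    simp [hg', hx]
  rw [a.hermForm_isolate {x} (f := g) (g := g) (by simpa using hgx) fun _ _ => rfl]
  have h0 : a.adjMat G *ᵥ ((-(f x * (w x)⁻¹)) • w) = 0 := by rw [mulVec_smul, hw, smul_zero]
  rw [hg', add_comm, hermForm_add hA]
  set v := (-(f x * (w x)⁻¹)) • w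
  have h1 : star f ⬝ᵥ (a.adjMat G *ᵥ v) = 0 := by rw [h0, dotProduct_zero]
  have h2 : (a.adjMat G).hermForm v = 0 := by rw [hermForm, h0, dotProduct_zero, Complex.zero_re]
  rw [h1, h2]
  simp

lemma star_single_dotProduct [DecidableEq V] (i : V) (c : ℂ) (f : V → ℂ) :
    star (Pi.single i c : V → ℂ) ⬝ᵥ f = star c * f i := by
  rw [Pi.star_single, single_dotProduct]

/-- Deleting a pendant vertex together with its neighbour lowers the index. -/
lemma index_isolate_add_one_le {u w : V} (huw : G.Adj u w) (hu : ∀ z, G.Adj u z → z = w) :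
    a.index (G.isolate {w}) + 1 ≤ a.index G := by
  classical
  obtain ⟨W, hW, hpos⟩ := exists_finrank_eq_posIndex (a.adjMat (G.isolate {w}))
  have hA := a.isHermitian_adjMat G
  set A := a.adjMat G with hAdef
  have hne : u ≠ w := huw.ne
  have huu : A u u = 0 := a.adjMat_of_not_adj (G.irrefl)
  have hww : A w w = 0 := a.adjMat_of_not_adj (G.irrefl)
  have huw' : A u w = a.toFun u w := a.adjMat_of_adj huw
  have hwu' : A w u = a.toFun w u := a.adjMat_of_adj huw.symm
  have hAu : ∀ f : V → ℂ, (A *ᵥ f) u = a.toFun u w * f w := by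
    intro f
    rw [mulVec, dotProduct, Finset.sum_eq_single w, huw']
    · intro z _ hz
      rw [hAdef, a.adjMat_of_not_adj fun h => hz (hu z h), zero_mul]
    · simp
  let P := kill ({u, w} : Set V)
  -- The coordinate at `u` is free, as `u` is isolated once `w` is; `α` sets it so that `A *ᵥ F f`
  -- vanishes at `w`. It also vanishes at `u`, so `F f` is orthogonal to `s`.
  let α : (V → ℂ) →ₗ[ℂ] ℂ := (-a.toFun u w) • (LinearMap.proj w).comp ((mulVecLin A).comp P)
  let F : (V → ℂ) →ₗ[ℂ] V → ℂ := P + (LinearMap.single ℂ (fun _ => ℂ) u).comp α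
  -- The positive direction of the single edge `u w`: the form takes the value 2 on `s`. It is the
  -- extra dimension.
  let s : V → ℂ := Pi.single w 1 + Pi.single u (a.toFun u w)
  let T : (W × ℂ) →ₗ[ℂ] V → ℂ :=
    (F.comp W.subtype).coprod ((LinearMap.id : ℂ →ₗ[ℂ] ℂ).smulRight s)
  have hPw : ∀ f, P f w = 0 := fun f => kill_of_mem (by simp) f
  have hFw : ∀ f, F f w = 0 := fun f => by simp [F, hPw, hne.symm]
  have hF : ∀ f, A.hermForm (F f) = (a.adjMat (G.isolate {w})).hermForm f := by
    intro f
    have h1 : G.isolate {w} = G.isolate {u, w} := by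
      refine le_antisymm (fun x y hxy => ⟨hxy.1, ?_, ?_⟩) (isolate_anti (by simp))
      · rintro (rfl | h)
        · exact hxy.2.2 (hu y hxy.1)
        · exact hxy.2.1 h
      · rintro (rfl | h)
        · exact hxy.2.1 (hu x hxy.1.symm)
        · exact hxy.2.2 h
    have h2 : F f = P f + Pi.single u (α f) := rfl
    rw [h1, a.hermForm_kill, h2, hermForm_add hA, star_single_dotProduct, hAu]
    have h3 : A.hermForm (Pi.single u (α f)) = 0 := by
      rw [hermForm, star_single_dotProduct, hAu]
      simp [hne.symm]
    rw [h3, hPw]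
    simp [P, hAdef]
  have hAF : ∀ f, (A *ᵥ F f) w = 0 := by
    intro f
    have h2 : F f = P f + Pi.single u (α f) := rfl
    have h3 : α f = -a.toFun u w * (A *ᵥ P f) w := rfl
    rw [h2, mulVec_add, Pi.add_apply, mulVec_single, h3]
    simp only [Pi.smul_apply, MulOpposite.smul_eq_mul_unop, MulOpposite.unop_op, col_apply, hwu']
    linear_combination (-(A *ᵥ P f) w) * a.mul_toFun u w
  have hs : ∀ (z : ℂ) (f : V → ℂ), star (z • s) ⬝ᵥ f =
      star z * f w + star (z * a.toFun u w) * f u := by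
    intro z f
    have : z • s = Pi.single w z + Pi.single u (z * a.toFun u w) := by
      simp [s, smul_add, ← Pi.single_smul]
    rw [this, star_add, add_dotProduct, star_single_dotProduct, star_single_dotProduct]
  have hAs : ∀ z : ℂ, A.hermForm (z • s) = 2 * Complex.normSq z := by
    intro z
    have h1 : (A *ᵥ s) u = a.toFun u w := by
      rw [hAu]; simp [s, hne.symm]
    have h2 : (A *ᵥ s) w = 1 := by
      simp only [s, mulVec_add, Pi.add_apply, mulVec_single]
      simp [hww, hwu']
      rw [mul_comm]
      exact a.mul_toFun u w
    rw [hermForm, mulVec_smul, hs, Pi.smul_apply, Pi.smul_apply, h1, h2, star_mul, a.star_toFun]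
    have h3 : star z * z • (1 : ℂ) + a.toFun w u * star z * z • a.toFun u w =
        2 * (star z * z) := by
      simp only [smul_eq_mul]
      linear_combination star z * z * a.mul_toFun w u
    rw [h3]
    have h4 : star z * z = (Complex.normSq z : ℂ) := by
      rw [Complex.normSq_eq_conj_mul_self]; rfl
    rw [h4]
    simp
  have hT : ∀ g, A.hermForm (T g) =
      (a.adjMat (G.isolate {w})).hermForm (g.1 : V → ℂ) + 2 * Complex.normSq g.2 := by
    intro g
    have : T g = F g.1 + g.2 • s := by simp [T]
    rw [this, hermForm_add hA, hF, hAs, hs, hAF, hAu, hFw]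
    simp
  have := finrank_le_posIndex T (A := A) fun g hg => by
    rw [hT]
    by_cases h1 : g.1 = 0
    · have h2 : g.2 ≠ 0 := fun h2 => hg (Prod.ext h1 h2)
      have := Complex.normSq_pos.mpr h2
      simp only [h1, ZeroMemClass.coe_zero, hermForm_zero]
      linarith
    · have h3 := hpos g.1 g.1.2 (by simpa using h1)
      have := Complex.normSq_nonneg g.2
      linarith
  rwa [Module.finrank_prod, Module.finrank_self, hW] at this

/-- For a bipartite graph, the index is at least the size of a side of the bipartition that
supports no null vector. -/
lemma ncard_le_index {J : Set V} (h1 : ∀ i ∈ J, ∀ j ∈ J, ¬ G.Adj i j)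
    (h2 : ∀ i ∉ J, ∀ j ∉ J, ¬ G.Adj i j)
    (hinj : ∀ g : V → ℂ, (∀ i ∉ J, g i = 0) → a.adjMat G *ᵥ g = 0 → g = 0) :
    J.ncard ≤ a.index G := by
  classical
  set A := a.adjMat G with hA'
  have hA : A.IsHermitian := a.isHermitian_adjMat G
  let e : (J → ℂ) →ₗ[ℂ] V → ℂ :=
    LinearMap.pi fun i => if h : i ∈ J then LinearMap.proj ⟨i, h⟩ else 0
  have he : ∀ g, ∀ i ∉ J, e g i = 0 := fun g i hi => by simp [e, hi]
  have he0 : ∀ g, e g = 0 → g = 0 := by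
    intro g hg
    ext ⟨i, hi⟩
    have := congrFun hg i
    simpa [e, hi] using this
  have hzero : ∀ f : V → ℂ, (∀ i ∉ J, f i = 0) → ∀ i ∈ J, (A *ᵥ f) i = 0 := by
    intro f hf i hi
    rw [mulVec, dotProduct]
    refine Finset.sum_eq_zero fun j _ => ?_
    by_cases hj : j ∈ J
    · rw [hA', a.adjMat_of_not_adj (h1 i hi j hj), zero_mul]
    · rw [hf j hj, mul_zero]
  have hzero' : ∀ f : V → ℂ, (∀ i ∈ J, f i = 0) → ∀ i ∉ J, (A *ᵥ f) i = 0 := by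
    intro f hf i hi
    rw [mulVec, dotProduct]
    refine Finset.sum_eq_zero fun j _ => ?_
    by_cases hj : j ∈ J
    · rw [hf j hj, mul_zero]
    · rw [hA', a.adjMat_of_not_adj (h2 i hi j hj), zero_mul]
  -- For `g` supported on `J`, both `g` and `A g` are isotropic, so the form at `g + A g` is the
  -- cross term, twice the squared norm of `A g`.
  have key := finrank_le_posIndex (e + (mulVecLin A).comp e) (A := A) fun g hg => by
    have h3 : (e + (mulVecLin A).comp e) g = e g + A *ᵥ e g := rfl
    have h4 : A.hermForm (e g) = 0 := by
      rw [hermForm, dotProduct, Finset.sum_eq_zero, Complex.zero_re]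
      intro i _
      by_cases hi : i ∈ J
      · rw [hzero _ (he g) i hi, mul_zero]
      · rw [Pi.star_apply, he g i hi, star_zero, zero_mul]
    have h5 : A.hermForm (A *ᵥ e g) = 0 := by
      rw [hermForm, dotProduct, Finset.sum_eq_zero, Complex.zero_re]
      intro i _
      by_cases hi : i ∈ J
      · rw [Pi.star_apply, hzero _ (he g) i hi, star_zero, zero_mul]
      · rw [hzero' _ (hzero _ (he g)) i hi, mul_zero]
    rw [h3, hermForm_add hA, h4, h5]
    have h6 : A *ᵥ e g ≠ 0 := fun h => hg (he0 g (hinj _ (he g) h))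
    obtain ⟨j, hj⟩ := Function.ne_iff.mp h6
    have h7 : 0 < (star (A *ᵥ e g) ⬝ᵥ (A *ᵥ e g)).re := by
      rw [dotProduct, Complex.re_sum]
      have h8 : ∀ i, (star (A *ᵥ e g) i * (A *ᵥ e g) i).re = Complex.normSq ((A *ᵥ e g) i) := by
        intro i
        simp [Complex.normSq_apply]
      simp only [h8]
      exact Finset.sum_pos' (fun i _ => Complex.normSq_nonneg _)
        ⟨j, Finset.mem_univ _, Complex.normSq_pos.mpr hj⟩
    linarith
  rwa [Module.finrank_fintype_fun_eq_card, ← Nat.card_eq_fintype_card, Nat.card_coe_set_eq] at key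

end UnitWeight

/-! ### Counting along even cycles -/

namespace SimpleGraph

variable {V : Type*} {G H : SimpleGraph V}

/-- Disjoint edges joining consecutive terms of a sequence extend any matching that avoids it. -/
lemma matchingNumber_isolate_seq_add_le [Finite V] {c : ℕ → V} (k : ℕ)
    (hinj : ∀ i < 2 * k, ∀ j < 2 * k, c i = c j → i = j)
    (hadj : ∀ i < k, G.Adj (c (2 * i)) (c (2 * i + 1))) :
    (G.isolate {x | ∃ i < 2 * k, x = c i}).matchingNumber + k ≤ G.matchingNumber := by
  induction k with
  | zero =>
    rw [add_zero]
    exact matchingNumber_mono (isolate_le _)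
  | succ k ih =>
    have h1 := ih (fun i hi j hj => hinj i (by omega) j (by omega)) fun i hi => hadj i (by omega)
    have hle : {x | ∃ i < 2 * k, x = c i} ⊆ {x | ∃ i < 2 * (k + 1), x = c i} := by
      rintro x ⟨i, hi, rfl⟩
      exact ⟨i, by omega, rfl⟩
    have h2 := matchingNumber_isolate_add_le (isolate_anti (G := G) hle)
      (u := c (2 * k)) (w := c (2 * k + 1)) ⟨hadj k (by omega), ?_, ?_⟩
      (fun z hz => hz.2.1 ⟨2 * k, by omega, rfl⟩) (fun z hz => hz.2.1 ⟨2 * k + 1, by omega, rfl⟩)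
    · omega
    · rintro ⟨i, hi, h⟩
      have := hinj _ (by omega) _ (by omega) h
      omega
    · rintro ⟨i, hi, h⟩
      have := hinj _ (by omega) _ (by omega) h
      omega

lemma IsCyclicSeq.ncard_alternate {ℓ : ℕ} {c : ℕ → V} (hc : G.IsCyclicSeq (2 * ℓ) c) :
    {x | ∃ k, x = c (2 * k)}.ncard = ℓ := by
  have h3 := hc.three_le
  have : {x | ∃ k, x = c (2 * k)} = (fun k => c (2 * k)) '' Set.Iio ℓ := by
    ext x
    constructor
    · rintro ⟨k, rfl⟩
      refine ⟨k % ℓ, Nat.mod_lt _ (by omega), ?_⟩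
      simp only
      rw [← Nat.mul_mod_mul_left, hc.apply_mod]
    · rintro ⟨k, -, rfl⟩
      exact ⟨k, rfl⟩
  have hinj : Set.InjOn (fun k => c (2 * k)) (Set.Iio ℓ) := by
    intro i hi j hj h
    rw [Set.mem_Iio] at hi hj
    have := hc.eq_of_lt (i := 2 * i) (j := 2 * j) (by omega) (by omega) h
    omega
  rw [this, hinj.ncard_image]
  simp [Set.ncard_eq_toFinset_card']

end SimpleGraph

/-! ### The lower bound, and what equality forces on the cycles -/

namespace UnitWeight

open SimpleGraph Matrix

variable {V : Type*} (a : UnitWeight V) {G H : SimpleGraph V}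

lemma star_prod_eq (c : ℕ → V) (n : ℕ) :
    star (∏ j ∈ Finset.range n, a.toFun (c (j + 1)) (c j)) =
      ∏ j ∈ Finset.range n, a.toFun (c j) (c (j + 1)) := by
  rw [star_prod]
  exact Finset.prod_congr rfl fun j _ => a.star_toFun _ _

variable [Fintype V]

theorem matchingNumber_sub_cyclomaticNumber_le (G : SimpleGraph V) :
    (G.matchingNumber : ℤ) - G.cyclomaticNumber ≤ a.index G := by
  induction hn : G.edgeSet.ncard using Nat.strong_induction_on generalizing G with
  | _ n ih =>
  by_cases hO : G.cyclePart = ⊥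
  · by_cases hG : G = ⊥
    · subst hG
      simp
    have h2 : G.cyclePart.MaxDegTwo := by
      rw [hO]
      exact fun _ _ _ _ h' => h'.elim
    rcases exists_pendant_or_cycle h2 (support_nonempty_iff.mpr hG) le_rfl
      boundaryLeOne_support with ⟨u, -, w, hw, hu⟩ | ⟨n, c, hc, -⟩
    · have h3 := ih _ (hn ▸ ncard_edgeSet_isolate_lt (Set.mem_singleton w) hw.symm) _ rfl
      have h4 := a.index_isolate_add_one_le hw hu
      have h5 := matchingNumber_le_isolate_add_one G w
      have h6 := cyclomaticNumber_mono (G.isolate_le {w})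
      omega
    · have := hc.cyclePart.adj 0
      rw [hO] at this
      exact this.elim
  · obtain ⟨x, hx⟩ := support_nonempty_iff.mpr hO
    obtain ⟨y, hy⟩ := id hx
    have h3 := ih _ (hn ▸ ncard_edgeSet_isolate_lt (Set.mem_singleton x) hy.1) _ rfl
    have h4 := a.index_isolate_le G {x}
    have h5 := matchingNumber_le_isolate_add_one G x
    have h6 := cyclomaticNumber_isolate_lt hx
    omega

/-- The index attains its lower bound `m(G) - c(G)`. -/
def Tight (G : SimpleGraph V) : Prop :=
  (a.index G : ℤ) = (G.matchingNumber : ℤ) - G.cyclomaticNumber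

variable {a}

/-- The chain m(G) - c(G) ≤ m(G - x) - c(G - x) ≤ p(G - x) ≤ p(G) collapses, so each estimate in it
is sharp. -/
lemma Tight.isolate_of_mem (h : a.Tight G) {x : V} (hx : x ∈ G.cyclePart.support) :
    a.Tight (G.isolate {x}) ∧ (G.isolate {x}).matchingNumber + 1 = G.matchingNumber ∧
      G.cyclomaticNumber = (G.isolate {x}).cyclomaticNumber + 1 := by
  have h3 := a.matchingNumber_sub_cyclomaticNumber_le (G.isolate {x})
  have h4 := a.index_isolate_le G {x}
  have h5 := matchingNumber_le_isolate_add_one G x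
  have h6 := cyclomaticNumber_isolate_lt hx
  unfold Tight at *
  refine ⟨?_, ?_, ?_⟩ <;> omega

lemma Tight.maxDegTwo (h : a.Tight G) : G.cyclePart.MaxDegTwo :=
  maxDegTwo_cyclePart fun _ hx => (h.isolate_of_mem hx).2.2.le

/-- The same collapse at a pendant edge. If `w` were on a cycle, c would also drop and leave a
surplus of 1 in p. -/
lemma Tight.isolate_of_pendant (h : a.Tight G) {u w : V} (huw : G.Adj u w)
    (hu : ∀ z, G.Adj u z → z = w) : w ∉ G.cyclePart.support ∧ a.Tight (G.isolate {w}) ∧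
      (G.isolate {w}).matchingNumber + 1 = G.matchingNumber := by
  have h3 := a.matchingNumber_sub_cyclomaticNumber_le (G.isolate {w})
  have h4 := a.index_isolate_add_one_le huw hu
  have h5 := matchingNumber_le_isolate_add_one G w
  have h6 := cyclomaticNumber_mono (G.isolate_le {w})
  have h7 := matchingNumber_isolate_add_le (isolate_le {w}) huw
        (fun z hz => hz.2.2 (hu z hz.1)) (fun z hz => hz.2.1 rfl)
  unfold Tight at *
  refine ⟨fun hw => ?_, ?_, ?_⟩
  · have := cyclomaticNumber_isolate_lt hw
    omega
  · omega
  · omega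

/-- Peeling a cycle: deleting every other vertex of an even cycle keeps the lower bound attained
if the remaining vertices, apart from one, have no neighbours outside the cycle. -/
lemma Tight.isolate_alternate (h : a.Tight G) {ℓ : ℕ} {c : ℕ → V}
    (hc : G.IsCyclicSeq (2 * ℓ) c)
    (hdeg : ∀ i, 1 ≤ i → i < ℓ → ∀ z, G.Adj (c (2 * i)) z →
      z = c (2 * i + 1) ∨ z = c (2 * i + (2 * ℓ - 1))) :
    a.Tight (G.isolate {x | ∃ i < ℓ, x = c (2 * i + 1)}) ∧
      (G.isolate {x | ∃ i < ℓ, x = c (2 * i + 1)}).matchingNumber + ℓ = G.matchingNumber := by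
  have h3 := hc.three_le
  suffices ∀ k, k + 1 ≤ ℓ → a.Tight (G.isolate {x | ∃ i < k + 1, x = c (2 * i + 1)}) ∧
      (G.isolate {x | ∃ i < k + 1, x = c (2 * i + 1)}).matchingNumber + (k + 1) =
        G.matchingNumber by
    have := this (ℓ - 1) (by omega)
    rwa [show ℓ - 1 + 1 = ℓ by omega] at this
  intro k
  induction k with
  | zero =>
    intro _
    have : {x | ∃ i < 0 + 1, x = c (2 * i + 1)} = {c 1} := by
      ext x
      simp
    rw [this]
    -- Only the first deletion uses the cycle; it opens the cycle into a path.
    have := h.isolate_of_mem (x := c 1) ⟨_, hc.cyclePart.adj 1⟩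
    exact ⟨this.1, by omega⟩
  | succ k ih =>
    intro hk
    obtain ⟨h4, h5⟩ := ih (by omega)
    set X := {x | ∃ i < k + 1, x = c (2 * i + 1)} with hX
    have hX' : {x | ∃ i < k + 1 + 1, x = c (2 * i + 1)} = X ∪ {c (2 * (k + 1) + 1)} := by
      ext x
      constructor
      · rintro ⟨i, hi, rfl⟩
        rcases Nat.lt_succ_iff_lt_or_eq.mp hi with hi | rfl
        · exact Or.inl ⟨i, hi, rfl⟩
        · exact Or.inr rfl
      · rintro (⟨i, hi, rfl⟩ | rfl)
        · exact ⟨i, by omega, rfl⟩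
        · exact ⟨k + 1, by omega, rfl⟩
    have hadj : (G.isolate X).Adj (c (2 * (k + 1))) (c (2 * (k + 1) + 1)) := by
      refine ⟨hc.adj _, ?_, ?_⟩
      · rintro ⟨i, hi, h'⟩
        have := hc.eq_of_lt (by omega) (by omega) h'
        omega
      · rintro ⟨i, hi, h'⟩
        have := hc.eq_of_lt (by omega) (by omega) h'
        omega
    -- Its predecessor `c (2 * k + 1)` being isolated, `c (2 * (k + 1))` is now pendant at the next
    -- vertex to delete.
    have := h4.isolate_of_pendant hadj fun z hz => by
      rcases hdeg (k + 1) (by omega) (by omega) z hz.1 with rfl | rfl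
      · rfl
      · refine absurd ⟨k, by omega, ?_⟩ hz.2.2
        rw [show 2 * (k + 1) + (2 * ℓ - 1) = 2 * k + 1 + 2 * ℓ by omega, hc.periodic]
    rw [hX', ← isolate_isolate]
    exact ⟨this.2.1, by omega⟩

variable (a)

lemma adjMat_mulVec_of_cycle {n : ℕ} {c : ℕ → V} (hc : G.IsCyclicSeq n c) {i : ℕ}
    (hdeg : ∀ z, G.Adj (c i) z → z = c (i + 1) ∨ z = c (i + (n - 1))) (f : V → ℂ) :
    (a.adjMat G *ᵥ f) (c i) = a.toFun (c i) (c (i + 1)) * f (c (i + 1)) +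
      a.toFun (c i) (c (i + (n - 1))) * f (c (i + (n - 1))) := by
  classical
  rw [mulVec, dotProduct, Finset.sum_eq_add _ _ (hc.succ_ne_pred i)]
  · rw [a.adjMat_of_adj (hc.adj i), a.adjMat_of_adj (hc.adj_pred i)]
  · intro z _ hz
    rw [a.adjMat_of_not_adj fun h => ?_, zero_mul]
    exact (hdeg z h).elim hz.1 hz.2
  · simp
  · simp

/-- In an even cycle, a null vector on one side of the bipartition determines the gain. -/
lemma prod_eq_of_mulVec_eq_zero {ℓ : ℕ} {c : ℕ → V} (hc : G.IsCyclicSeq (2 * ℓ) c)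
    (hdeg : ∀ i z, G.Adj (c i) z → z = c (i + 1) ∨ z = c (i + (2 * ℓ - 1))) {g : V → ℂ}
    (hg : g ≠ 0) (hg0 : ∀ x, (∀ k, x ≠ c (2 * k)) → g x = 0) (hA : a.adjMat G *ᵥ g = 0) :
    ∏ j ∈ Finset.range (2 * ℓ), a.toFun (c j) (c (j + 1)) = (-1) ^ ℓ := by
  have h3 := hc.three_le
  -- The null equation at the odd vertex `c (2 * k + 1)` links its two even neighbours. One full
  -- turn multiplies `g (c 0)` by the signed gain of the reversed cycle, which must be 1.
  have step : ∀ k, g (c (2 * (k + 1))) =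
      -(a.toFun (c (2 * k + 2)) (c (2 * k + 1)) * a.toFun (c (2 * k + 1)) (c (2 * k))) *
        g (c (2 * k)) := by
    intro k
    have h1 := a.adjMat_mulVec_of_cycle hc (i := 2 * k + 1) (hdeg _) g
    rw [hA, show 2 * k + 1 + (2 * ℓ - 1) = 2 * k + 2 * ℓ by omega, hc.periodic,
      show 2 * k + 1 + 1 = 2 * k + 2 by omega, Pi.zero_apply] at h1
    rw [show 2 * (k + 1) = 2 * k + 2 by omega]
    linear_combination (-a.toFun (c (2 * k + 2)) (c (2 * k + 1))) * h1 -
      g (c (2 * k + 2)) * a.mul_toFun (c (2 * k + 2)) (c (2 * k + 1))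
  have hval : ∀ k, g (c (2 * k)) =
      (-1) ^ k * (∏ j ∈ Finset.range (2 * k), a.toFun (c (j + 1)) (c j)) * g (c 0) := by
    intro k
    induction k with
    | zero => simp
    | succ k ih =>
      rw [step, ih, show 2 * (k + 1) = 2 * k + 1 + 1 by omega, Finset.prod_range_succ,
        Finset.prod_range_succ, pow_succ]
      ring
  have h0 : g (c 0) ≠ 0 := by
    intro h0
    refine hg (funext fun x => ?_)
    by_cases hx : ∃ k, x = c (2 * k)
    · obtain ⟨k, rfl⟩ := hx
      rw [hval, h0, mul_zero]
      rfl
    · push Not at hx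
      exact hg0 x hx
  have h1 := hval ℓ
  have h2 : c (2 * ℓ) = c 0 := by simpa using hc.periodic 0
  rw [h2] at h1
  have h4 : (-1) ^ ℓ * ∏ j ∈ Finset.range (2 * ℓ), a.toFun (c (j + 1)) (c j) = 1 :=
    mul_right_cancel₀ h0 (by rw [← h1, one_mul])
  rw [← a.star_prod_eq]
  have h5 : ∏ j ∈ Finset.range (2 * ℓ), a.toFun (c (j + 1)) (c j) = (-1) ^ ℓ := by
    have h6 : ((-1 : ℂ) ^ ℓ) * (-1) ^ ℓ = 1 := by rw [← mul_pow]; simp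
    linear_combination ((-1) ^ ℓ) * h4 -
      (∏ j ∈ Finset.range (2 * ℓ), a.toFun (c (j + 1)) (c j)) * h6
  rw [h5]
  simp

variable {a}

/-- A cycle whose index attains the lower bound is of Type A. -/
lemma Tight.prod_eq_of_support (h : a.Tight G) {n : ℕ} {c : ℕ → V} (hc : G.IsCyclicSeq n c)
    (hsupp : G.support ⊆ Set.range c)
    (hdeg : ∀ i z, G.Adj (c i) z → z = c (i + 1) ∨ z = c (i + (n - 1))) :
    Even n ∧ ∏ j ∈ Finset.range n, a.toFun (c j) (c (j + 1)) = (-1) ^ (n / 2) := by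
  have h3 := hc.three_le
  obtain ⟨-, h4, h5⟩ := h.isolate_of_mem (x := c 0) ⟨_, hc.cyclePart.adj 0⟩
  have h6 := cyclomaticNumber_nonneg (G.isolate {c 0})
  have h7 := two_mul_matchingNumber_le G
  have h8 := Set.ncard_le_ncard hsupp (Set.toFinite _)
  rw [hc.ncard_range] at h8
  rcases Nat.even_or_odd n with hn | hn
  · obtain ⟨ℓ, hℓ⟩ := hn.two_dvd
    subst hℓ
    refine ⟨hn, ?_⟩
    rw [Nat.mul_div_cancel_left _ (by omega)]
    by_contra hne
    -- Here m ≤ ℓ and c ≥ 1. With a wrong gain no null vector lives on the even vertices, and the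
    -- index would be at least ℓ.
    have hlt : a.index G < ℓ := by
      unfold Tight at h
      omega
    refine absurd (a.ncard_le_index (J := {x | ∃ k, x = c (2 * k)}) (G := G) ?_ ?_ ?_)
      (not_le.mpr (by rwa [hc.ncard_alternate]))
    · rintro _ ⟨k, rfl⟩ _ ⟨j, rfl⟩ hadj
      rcases hdeg _ _ hadj with h' | h'
      · have := (hc.modEq _ _ h').of_mul_right ℓ
        unfold Nat.ModEq at this
        omega
      · have := (hc.modEq _ _ h').of_mul_right ℓ
        unfold Nat.ModEq at this
        omega
    · intro x hx y hy hadj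
      obtain ⟨i, rfl⟩ := hsupp ⟨y, hadj⟩
      rcases Nat.even_or_odd' i with ⟨k, rfl | rfl⟩
      · exact hx ⟨k, rfl⟩
      · rcases hdeg _ _ hadj with h' | h'
        · exact hy ⟨k + 1, h'⟩
        · exact hy ⟨k + ℓ, by rw [h']; congr 1; omega⟩
    · intro g hg hA
      by_contra hg'
      refine hne (a.prod_eq_of_mulVec_eq_zero hc hdeg hg' (fun x hx => hg x ?_) hA)
      rintro ⟨k, rfl⟩
      exact hx k rfl
  · exfalso
    obtain ⟨ℓ, rfl⟩ := hn
    -- On an odd cycle, G - `c 0` still has ℓ disjoint edges, so equality would give m(G) ≥ ℓ + 1 on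
    -- only 2ℓ + 1 vertices.
    have := matchingNumber_isolate_seq_add_le (G := G.isolate {c 0}) (c := fun i => c (i + 1)) ℓ
      (fun i hi j hj h' => by have := hc.eq_of_lt (by omega) (by omega) h'; omega)
      (fun i hi => ⟨hc.adj _, fun h' => ?_, fun h' => ?_⟩)
    · omega
    · have := hc.eq_of_lt (by omega) (by omega) h'
      omega
    · have := hc.eq_of_lt (by omega) (by omega) h'
      omega

/-- If the lower bound is attained, then every cycle is of Type A. -/
theorem Tight.prod_eq (h : a.Tight G) {n : ℕ} {c : ℕ → V} (hc : G.IsCyclicSeq n c) :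
    Even n ∧ ∏ j ∈ Finset.range n, a.toFun (c j) (c (j + 1)) = (-1) ^ (n / 2) := by
  induction hN : G.edgeSet.ncard using Nat.strong_induction_on generalizing G with
  | _ N ih =>
  have hdel : ∀ x ∉ Set.range c, G.IsCyclicSeq n c → (G.isolate {x}).IsCyclicSeq n c := by
    intro x hx hc
    refine { hc with adj := fun i => ⟨hc.adj i, ?_, ?_⟩ }
    · rintro rfl; exact hx ⟨_, rfl⟩
    · rintro rfl; exact hx ⟨_, rfl⟩
  have hcO : Set.range c ⊆ G.cyclePart.support := by
    rintro _ ⟨i, rfl⟩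
    exact ⟨_, hc.cyclePart.adj i⟩
  have hpend : ∀ u w, G.Adj u w → (∀ z, G.Adj u z → z = w) →
      Even n ∧ ∏ j ∈ Finset.range n, a.toFun (c j) (c (j + 1)) = (-1) ^ (n / 2) := by
    intro u w huw hu
    obtain ⟨hw, ht, -⟩ := h.isolate_of_pendant huw hu
    exact ih _ (hN ▸ ncard_edgeSet_isolate_lt (Set.mem_singleton w) huw.symm) ht
      (hdel w (fun h' => hw (hcO h')) hc) rfl
  -- Cycle vertices off `c` and neighbours of pendant vertices can be deleted without harming `c`.
  -- When neither is available, `c` is the only cycle and the graph has no other edges.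
  by_cases hO : G.cyclePart.support ⊆ Set.range c
  · have h2 := h.maxDegTwo
    have hne : G.support.Nonempty := ⟨c 0, _, hc.adj 0⟩
    rcases exists_pendant_or_cycle h2 hne le_rfl boundaryLeOne_support with
      ⟨u, -, w, hw, hu⟩ | ⟨m, d, hd, -, hbd, hin⟩
    · exact hpend u w hw hu
    have hdc : Set.range d ⊆ Set.range c := by
      rintro _ ⟨i, rfl⟩
      exact hO ⟨_, hd.cyclePart.adj i⟩
    have hcd : Set.range c = Set.range d := by
      refine le_antisymm ?_ hdc
      obtain ⟨j, hj⟩ := hdc ⟨0, rfl⟩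
      exact hd.cyclePart.range_subset h2 hc.cyclePart (j := j) ⟨0, hj.symm⟩
    rw [← hcd] at hbd hin
    by_cases hS : (G.support \ Set.range c).Nonempty
    · have hbd' : G.BoundaryLeOne (G.support \ Set.range c) := by
        intro x x' y y' hx hx' hy hy' h1 h1'
        have hmem : ∀ x y, G.Adj x y → y ∉ G.support \ Set.range c → y ∈ Set.range c := by
          intro x y hxy hy
          by_contra h'
          exact hy ⟨⟨x, hxy.symm⟩, h'⟩
        exact (hbd (hmem x y h1 hy) (hmem x' y' h1' hy') hx.2 hx'.2 h1.symm h1'.symm).symm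
      rcases exists_pendant_or_cycle h2 hS Set.sdiff_subset hbd' with
        ⟨u, -, w, hw, hu⟩ | ⟨m, e, he, hsub, -⟩
      · exact hpend u w hw hu
      · exact absurd (hO ⟨_, he.cyclePart.adj 0⟩) (hsub ⟨0, rfl⟩).2
    · rw [Set.not_nonempty_iff_eq_empty, Set.sdiff_eq_empty] at hS
      refine h.prod_eq_of_support hc hS fun i z hz => ?_
      exact hc.cyclePart.eq_or_eq_of_adj h2 (hin _ ⟨i, rfl⟩ _ (hS ⟨_, hz.symm⟩) hz)
  · obtain ⟨x, hx, hxc⟩ := Set.not_subset.mp hO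
    obtain ⟨y, hy⟩ := id hx
    exact ih _ (hN ▸ ncard_edgeSet_isolate_lt (Set.mem_singleton x) hy.1)
      (h.isolate_of_mem hx).1 (hdel x hxc hc) rfl

end UnitWeight

/-! ### Deleting one of several disjoint cycles -/

namespace SimpleGraph

variable {V : Type*} {G : SimpleGraph V}

/-- Deleting some vertices of a cycle that is disjoint from all other cycles destroys this cycle
and no other. -/
lemma IsCyclicSeq.cyclePart_isolate {n : ℕ} {c : ℕ → V} (hc : G.IsCyclicSeq n c)
    (h2 : G.cyclePart.MaxDegTwo) {X : Set V} (hX : X ⊆ Set.range c) (hne : X.Nonempty) :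
    (G.isolate X).cyclePart = G.cyclePart.isolate (Set.range c) := by
  -- A surviving cycle through a vertex of `c` would contain all of `c`, including the deleted
  -- vertices.
  have key : ∀ u v, (G.isolate X).cyclePart.Adj u v → u ∉ Set.range c := by
    rintro u v huv ⟨i, rfl⟩
    obtain ⟨m, d, hd, hd0, -⟩ := exists_isCyclicSeq_of_cyclePart_adj huv
    obtain ⟨x, hx⟩ := hne
    obtain ⟨j, hj⟩ := (hd.mono (isolate_le X)).cyclePart.range_subset h2 hc.cyclePart (j := i)
      ⟨0, hd0⟩ (hX hx)
    exact (hd.adj j).2.1 (hj ▸ hx)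
  refine le_antisymm (fun u v huv => ⟨cyclePart_mono (isolate_le X) huv, key u v huv,
    key v u huv.symm⟩) fun u v huv => ?_
  obtain ⟨m, d, hd, rfl, rfl⟩ := exists_isCyclicSeq_of_cyclePart_adj huv.1
  have hdX : ∀ i, d i ∉ X := fun i hi =>
    huv.2.1 (hc.cyclePart.range_subset h2 hd.cyclePart (hX hi) ⟨0, rfl⟩)
  have hd' : (G.isolate X).IsCyclicSeq m d :=
    { hd with adj := fun i => ⟨hd.adj i, hdX _, hdX _⟩ }
  exact hd'.cyclePart.adj 0

lemma IsCyclicSeq.support_isolate_range {n : ℕ} {c : ℕ → V} (hc : G.IsCyclicSeq n c)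
    (h2 : G.MaxDegTwo) : (G.isolate (Set.range c)).support = G.support \ Set.range c := by
  ext u
  constructor
  · rintro ⟨v, hv⟩
    exact ⟨⟨v, hv.1⟩, hv.2.1⟩
  · rintro ⟨⟨v, hv⟩, hu⟩
    exact ⟨v, hv, hu, fun hv' => hu (hc.mem_range_of_adj h2 hv' hv.symm)⟩

lemma IsCyclicSeq.range_subset_support {n : ℕ} {c : ℕ → V} (hc : G.IsCyclicSeq n c) :
    Set.range c ⊆ G.support := by
  rintro _ ⟨i, rfl⟩
  exact ⟨_, hc.adj i⟩

lemma IsCyclicSeq.ncard_support [Finite V] {n : ℕ} {c : ℕ → V} (hc : G.IsCyclicSeq n c)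
    (h2 : G.MaxDegTwo) :
    G.support.ncard = (G.isolate (Set.range c)).support.ncard + n := by
  rw [hc.support_isolate_range h2]
  have := Set.ncard_sdiff_add_ncard_of_subset hc.range_subset_support (Set.toFinite _)
  rwa [hc.ncard_range, eq_comm] at this

lemma IsCyclicSeq.range_shift {n : ℕ} {c : ℕ → V} (hc : G.IsCyclicSeq n c) (k : ℕ) :
    Set.range (fun i => c (i + k)) = Set.range c := by
  ext x
  constructor
  · rintro ⟨i, rfl⟩
    exact ⟨_, rfl⟩
  · rintro ⟨i, rfl⟩
    have h3 := hc.three_le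
    obtain ⟨m, rfl⟩ : ∃ m, n = m + 1 := ⟨n - 1, by omega⟩
    refine ⟨i + k * m, ?_⟩
    simp only
    rw [show i + k * m + k = i + k * (m + 1) by ring, hc.apply_add_mul]

lemma IsCyclicSeq.ne_of_odd_of_even {ℓ : ℕ} {c : ℕ → V} (hc : G.IsCyclicSeq (2 * ℓ) c) (i j : ℕ) :
    c (2 * i + 1) ≠ c (2 * j) := by
  intro h
  have := (hc.modEq _ _ h).of_mul_right ℓ
  unfold Nat.ModEq at this
  omega

end SimpleGraph

/-! ### The vertex cover forced by equality -/

namespace UnitWeight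

open SimpleGraph

variable {V : Type*} [Fintype V] {a : UnitWeight V} {G H : SimpleGraph V}

/-- If the lower bound is attained, then the edges on no cycle are covered by a set of vertices on
no cycle that is no larger than a matching of the graph induced on the vertices on no cycle. -/
theorem Tight.exists_cover (h : a.Tight G) : ∃ K : Set V, Disjoint K G.cyclePart.support ∧
    (∀ u v, G.Adj u v → ¬ G.cyclePart.Adj u v → u ∈ K ∨ v ∈ K) ∧
    K.ncard ≤ (G.isolate G.cyclePart.support).matchingNumber ∧
    2 * G.matchingNumber = 2 * K.ncard + G.cyclePart.support.ncard := by
  -- The last conjunct strengthens the induction: it fixes the size of K by m, so covers obtained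
  -- from different peelings can be compared.
  induction hN : G.edgeSet.ncard using Nat.strong_induction_on generalizing G with
  | _ N ih =>
  by_cases hG : G = ⊥
  · subst hG
    have : (⊥ : SimpleGraph V).cyclePart = ⊥ := le_bot_iff.mp cyclePart_le
    have h0 : (⊥ : SimpleGraph V).support = ∅ := by
      rw [← Set.not_nonempty_iff_eq_empty, support_nonempty_iff]
      simp
    exact ⟨∅, by simp, by simp, by simp, by simp [this, h0]⟩
  have h2 := h.maxDegTwo
  rcases exists_pendant_or_cycle h2 (support_nonempty_iff.mpr hG) le_rfl
    boundaryLeOne_support with ⟨u, -, w, hw, hu⟩ | ⟨n, c, hc, -, hbd, hin⟩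
  · obtain ⟨hwO, ht, hm⟩ := h.isolate_of_pendant hw hu
    have hO : (G.isolate {w}).cyclePart = G.cyclePart := cyclePart_isolate (by simpa using hwO)
    obtain ⟨K, hK1, hK2, hK3, hK4⟩ :=
      ih _ (hN ▸ ncard_edgeSet_isolate_lt (Set.mem_singleton w) hw.symm) ht rfl
    rw [hO] at hK1 hK2 hK3 hK4
    have huO : u ∉ G.cyclePart.support := by
      intro huO
      obtain ⟨z, hz⟩ := huO
      obtain rfl := hu z hz.1
      exact hwO ⟨u, SimpleGraph.Adj.symm (G := G.cyclePart) hz⟩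
    have h5 : ((G.isolate {w}).isolate G.cyclePart.support).matchingNumber + 1 ≤
        (G.isolate G.cyclePart.support).matchingNumber :=
      matchingNumber_isolate_add_le (isolate_mono (isolate_le _) _) (u := u) (w := w)
        ⟨hw, huO, hwO⟩ (fun z hz => hz.1.2.2 (hu z hz.1.1)) (fun z hz => hz.1.2.1 rfl)
    have h6 : 2 * G.matchingNumber ≤ 2 * (insert w K).ncard + G.cyclePart.support.ncard := by
      refine two_mul_matchingNumber_le_of_cover fun x y hxy hn => ?_
      by_cases hx : x = w
      · exact Or.inl (hx ▸ Set.mem_insert _ _)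
      by_cases hy : y = w
      · exact Or.inr (hy ▸ Set.mem_insert _ _)
      exact (hK2 x y ⟨hxy, hx, hy⟩ hn).imp (Set.mem_insert_of_mem _) (Set.mem_insert_of_mem _)
    have h7 := Set.ncard_insert_le w K
    refine ⟨insert w K, ?_, fun x y hxy hn => ?_, by omega, by omega⟩
    · rw [Set.disjoint_insert_left]
      exact ⟨hwO, hK1⟩
    · by_cases hx : x = w
      · exact Or.inl (hx ▸ Set.mem_insert _ _)
      by_cases hy : y = w
      · exact Or.inr (hy ▸ Set.mem_insert _ _)
      exact (hK2 x y ⟨hxy, hx, hy⟩ hn).imp (Set.mem_insert_of_mem _) (Set.mem_insert_of_mem _)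
  -- An end cycle has at most one vertex with neighbours outside; shifting by `k` makes it `e 0`.
  · obtain ⟨k, hk⟩ : ∃ k, ∀ i, c i ≠ c k → ∀ z, G.Adj (c i) z → z ∈ Set.range c := by
      by_cases hex : ∃ k z, G.Adj (c k) z ∧ z ∉ Set.range c
      · obtain ⟨k, z, hz, hzc⟩ := hex
        refine ⟨k, fun i hi y hy => ?_⟩
        by_contra hyc
        exact hi (hbd ⟨i, rfl⟩ ⟨k, rfl⟩ hyc hzc hy hz).1
      · push Not at hex
        exact ⟨0, fun i _ => hex i⟩
    have hrange := hc.range_shift k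
    have hc' := hc.shift k
    obtain ⟨ℓ, rfl⟩ := (h.prod_eq hc).1.two_dvd
    have h3 := hc.three_le
    set e : ℕ → V := fun i => c (i + k) with he
    rw [← hrange] at hin
    have hdeg : ∀ i, e i ≠ e 0 → ∀ z, G.Adj (e i) z →
        z = e (i + 1) ∨ z = e (i + (2 * ℓ - 1)) := by
      intro i hi z hz
      refine hc'.cyclePart.eq_or_eq_of_adj h2 (hin _ ⟨i, rfl⟩ _ ?_ hz)
      rw [hrange]
      exact hk (i + k) (by simpa [he] using hi) z hz
    -- The cycle is peeled in two ways. Isolating the odd vertices `X` leaves the attaching vertex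
    -- `e 0` with its outside edge. Isolating the even vertices `Y`, which include `e 0`, detaches
    -- the whole cycle. Each lowers m by exactly ℓ, so the resulting covers `K` and `L` have equal
    -- size.
    set X := {x | ∃ i < ℓ, x = e (2 * i + 1)} with hX
    set Y := {x | ∃ i < ℓ, x = e (2 * i + 1 + 1)} with hY
    obtain ⟨htX, hmX⟩ := h.isolate_alternate hc' fun i hi hi' z hz => by
      refine hdeg (2 * i) (fun h' => ?_) z hz
      have := hc'.eq_of_lt (by omega) (by omega) h'
      omega
    obtain ⟨htY, hmY⟩ := h.isolate_alternate (hc'.shift 1) fun i hi hi' z hz => by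
      have := hdeg (2 * i + 1) (fun h' => ?_) z hz
      · rwa [show 2 * i + 1 + (2 * ℓ - 1) = 2 * i + (2 * ℓ - 1) + 1 by omega] at this
      · exact hc'.ne_of_odd_of_even i 0 h'
    have hXr : X ⊆ Set.range e := by
      rintro _ ⟨i, -, rfl⟩
      exact ⟨_, rfl⟩
    have hYr : Y ⊆ Set.range e := by
      rintro _ ⟨i, -, rfl⟩
      exact ⟨_, rfl⟩
    have hcov : ∀ i, e i ∈ X ∨ e i ∈ Y := by
      intro i
      have hlt : (i + (2 * ℓ - 1)) % (2 * ℓ) < 2 * ℓ := Nat.mod_lt _ (by omega)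
      have hi : e ((i + (2 * ℓ - 1)) % (2 * ℓ) + 1) = e i := by
        refine hc'.apply_eq_of_modEq ?_
        have h4 : (i + (2 * ℓ - 1)) % (2 * ℓ) + 1 ≡ i + (2 * ℓ - 1) + 1 [MOD 2 * ℓ] :=
          (Nat.mod_modEq _ _).add_right 1
        rw [show i + (2 * ℓ - 1) + 1 = i + 2 * ℓ by omega] at h4
        exact h4.trans (by simp [Nat.ModEq])
      rcases Nat.even_or_odd' ((i + (2 * ℓ - 1)) % (2 * ℓ)) with ⟨j, hj | hj⟩
      · exact Or.inl ⟨j, by omega, by rw [← hi, hj]⟩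
      · exact Or.inr ⟨j, by omega, by rw [← hi, hj]⟩
    have heX : e 1 ∈ X := ⟨0, by omega, rfl⟩
    have heY : e 2 ∈ Y := ⟨0, by omega, rfl⟩
    have hNX := hc'.cyclePart_isolate h2 hXr ⟨_, heX⟩
    have hNY := hc'.cyclePart_isolate h2 hYr ⟨_, heY⟩
    obtain ⟨K, hK1, hK2, hK3, hK4⟩ :=
      ih _ (hN ▸ ncard_edgeSet_isolate_lt heX (hc'.adj 1)) htX rfl
    obtain ⟨L, hL1, hL2, hL3, hL4⟩ :=
      ih _ (hN ▸ ncard_edgeSet_isolate_lt heY (hc'.adj 2)) htY rfl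
    change 2 * (G.isolate X).matchingNumber = _ at hK4
    change (G.isolate X).matchingNumber + ℓ = _ at hmX
    change 2 * (G.isolate Y).matchingNumber = _ at hL4
    change L.ncard ≤ ((G.isolate Y).isolate _).matchingNumber at hL3
    change (G.isolate Y).matchingNumber + ℓ = _ at hmY
    change (G.isolate Y).cyclePart = _ at hNY
    rw [hNX] at hK1 hK2 hK3 hK4
    simp only [← hY, hNY] at hL1 hL2 hL3 hL4
    set N' := G.cyclePart.isolate (Set.range e) with hN'
    have hsupp : G.cyclePart.support.ncard = N'.support.ncard + 2 * ℓ :=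
      hc'.cyclePart.ncard_support h2
    have hYe : ∀ x y, (G.isolate Y).Adj x y → x ∉ Set.range e := by
      rintro x y hxy ⟨i, rfl⟩
      have hyx : ∀ i, e i ∈ X → ¬ (G.isolate Y).Adj (e i) y := by
        rintro i ⟨j, hj, hij⟩ hiy
        rw [hij] at hiy
        rcases hdeg _ (hc'.ne_of_odd_of_even j 0) y hiy.1 with hy | hy
        · exact hiy.2.2 ⟨j, hj, hy⟩
        · refine (hcov (2 * j + 1 + (2 * ℓ - 1))).elim ?_ (hy ▸ hiy.2.2)
          rintro ⟨m, hm, hm'⟩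
          refine hc'.ne_of_odd_of_even m (j + ℓ) ?_
          rw [← hm']
          congr 1
          omega
      exact (hcov i).elim (fun hi => hyx i hi hxy) hxy.2.1
    have hKe : 2 * (G.isolate Y).matchingNumber ≤
        2 * (K \ Set.range e).ncard + N'.support.ncard := by
      refine two_mul_matchingNumber_le_of_cover fun x y hxy hn => ?_
      have hx := hYe x y hxy
      have hy := hYe y x hxy.symm
      refine (hK2 x y ⟨hxy.1, fun h' => hx (hXr h'), fun h' => hy (hXr h')⟩ hn).imp ?_ ?_
      · exact fun h' => ⟨h', hx⟩
      · exact fun h' => ⟨h', hy⟩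
    -- The part of `K` off the cycle already covers the bridges of the detached graph, so it cannot
    -- be smaller than `L`; thus `K` avoids the cycle, in particular `e 0`. The bound by a matching
    -- off all cycles is taken from `L`.
    have hKeq : K \ Set.range e = K :=
      Set.eq_of_subset_of_ncard_le Set.sdiff_subset (by omega) (Set.toFinite _)
    have hKdisj : Disjoint K (Set.range e) := by
      rw [← hKeq]
      exact Set.disjoint_sdiff_left
    have hO : G.cyclePart.support ⊆ N'.support ∪ Set.range e := by
      rw [hN', hc'.cyclePart.support_isolate_range h2]
      intro x hx
      by_cases hxe : x ∈ Set.range e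
      · exact Or.inr hxe
      · exact Or.inl ⟨hx, hxe⟩
    have hmono : (G.isolate Y).isolate N'.support ≤ G.isolate G.cyclePart.support := by
      refine fun x y hxy => ⟨hxy.1.1, fun h' => ?_, fun h' => ?_⟩
      · exact (hO h').elim hxy.2.1 (hYe x y hxy.1)
      · exact (hO h').elim hxy.2.2 (hYe y x hxy.1.symm)
    have h8 := matchingNumber_mono hmono
    refine ⟨K, Disjoint.mono_right hO (Set.disjoint_union_right.mpr ⟨hK1, hKdisj⟩),
      fun x y hxy hn => ?_, by omega, by omega⟩
    have hnX : ∀ x y, G.Adj x y → ¬ G.cyclePart.Adj x y → x ∉ X := by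
      rintro x y hxy hn ⟨i, hi, rfl⟩
      refine hn (hin _ ⟨_, rfl⟩ _ ?_ hxy)
      rcases hdeg _ (hc'.ne_of_odd_of_even i 0) y hxy with rfl | rfl
      · exact ⟨_, rfl⟩
      · exact ⟨_, rfl⟩
    exact hK2 x y ⟨hxy, hnX x y hxy hn, hnX y x hxy.symm fun h' => hn h'.symm⟩
      fun h' => hn h'.1

end UnitWeight

/-! ### Sufficiency: Type A cycles and a small cover -/

namespace UnitWeight

open SimpleGraph Matrix

variable {V : Type*} [Fintype V] (a : UnitWeight V) {G H : SimpleGraph V}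

/-- An even cycle of Type A carries a null vector. -/
lemma exists_mulVec_eq_zero {ℓ : ℕ} {c : ℕ → V} (hc : G.IsCyclicSeq (2 * ℓ) c)
    (hdeg : ∀ i z, G.Adj (c i) z → z = c (i + 1) ∨ z = c (i + (2 * ℓ - 1)))
    (hprod : ∏ j ∈ Finset.range (2 * ℓ), a.toFun (c j) (c (j + 1)) = (-1) ^ ℓ) :
    ∃ w : V → ℂ, a.adjMat G *ᵥ w = 0 ∧ w (c 0) ≠ 0 := by
  classical
  have h3 := hc.three_le
  let F : ℕ → ℂ := fun k => (-1) ^ k * ∏ j ∈ Finset.range (2 * k), a.toFun (c (j + 1)) (c j)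
  have hF0 : F 0 = 1 := by simp [F]
  have hFs : ∀ k, F (k + 1) =
      -(a.toFun (c (2 * k + 2)) (c (2 * k + 1)) * a.toFun (c (2 * k + 1)) (c (2 * k))) * F k := by
    intro k
    simp only [F]
    rw [show 2 * (k + 1) = 2 * k + 1 + 1 by omega, Finset.prod_range_succ,
      Finset.prod_range_succ, pow_succ]
    ring
  -- The Type A gain is exactly what makes the values prescribed by the odd rows close up after one
  -- turn, so that `w` is well defined.
  have hFp : Function.Periodic F ℓ := by
    intro k
    induction k with
    | zero =>
      simp only [F, zero_add]
      rw [← star_star (∏ j ∈ Finset.range (2 * ℓ), a.toFun (c (j + 1)) (c j)), a.star_prod_eq,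
        hprod, star_pow, star_neg, star_one, ← mul_pow]
      simp
    | succ k ih =>
      rw [show k + 1 + ℓ = k + ℓ + 1 by omega, hFs, hFs, ih,
        show 2 * (k + ℓ) + 2 = 2 * k + 2 + 2 * ℓ by omega,
        show 2 * (k + ℓ) + 1 = 2 * k + 1 + 2 * ℓ by omega,
        show 2 * (k + ℓ) = 2 * k + 2 * ℓ by omega, hc.periodic, hc.periodic, hc.periodic]
  let w : V → ℂ := fun x => if h : ∃ k, x = c (2 * k) then F h.choose else 0
  have hw : ∀ k, w (c (2 * k)) = F k := by
    intro k
    have hex : ∃ k', c (2 * k) = c (2 * k') := ⟨k, rfl⟩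
    have h1 : w (c (2 * k)) = F hex.choose := dif_pos hex
    have h2 := hc.modEq _ _ hex.choose_spec
    have h4 := Nat.ModEq.mul_left_cancel' (by norm_num : (2 : ℕ) ≠ 0) h2
    rw [h1, ← hFp.map_mod_nat k, ← hFp.map_mod_nat hex.choose, h4]
  refine ⟨w, funext fun x => ?_, by rw [show c 0 = c (2 * 0) from rfl, hw, hF0]; simp⟩
  by_cases hx : ∃ k, x = c (2 * k + 1)
  · obtain ⟨k, rfl⟩ := hx
    rw [a.adjMat_mulVec_of_cycle hc (hdeg _),
      show 2 * k + 1 + (2 * ℓ - 1) = 2 * k + 2 * ℓ by omega, hc.periodic,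
      show 2 * k + 1 + 1 = 2 * (k + 1) by omega, hw, hw, hFs,
      show 2 * k + 2 = 2 * (k + 1) by omega, Pi.zero_apply]
    linear_combination (-a.toFun (c (2 * k + 1)) (c (2 * k)) * F k) *
      a.mul_toFun (c (2 * k + 1)) (c (2 * (k + 1)))
  · rw [mulVec, dotProduct, Pi.zero_apply]
    refine Finset.sum_eq_zero fun z _ => ?_
    by_cases hz : ∃ k, z = c (2 * k)
    · obtain ⟨k, rfl⟩ := hz
      rw [a.adjMat_of_not_adj fun h => hx ?_, zero_mul]
      rcases hdeg _ _ h.symm with h | h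
      · exact ⟨k, h⟩
      · exact ⟨k + (ℓ - 1), by rw [h]; congr 1; omega⟩
    · have : w z = 0 := dif_neg hz
      rw [this, mul_zero]

/-- A graph whose components are isolated vertices and cycles of Type A. -/
lemma index_add_cyclomaticNumber_le (h2 : G.MaxDegTwo)
    (hA : ∀ u v, G.Adj u v → ∃ n c, G.IsCyclicSeq n c ∧ c 0 = u ∧ c 1 = v ∧ Even n ∧
      ∏ j ∈ Finset.range n, a.toFun (c j) (c (j + 1)) = (-1) ^ (n / 2)) :
    a.index G + G.cyclomaticNumber ≤ G.matchingNumber := by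
  induction hN : G.edgeSet.ncard using Nat.strong_induction_on generalizing G with
  | _ N ih =>
  by_cases hG : G = ⊥
  · subst hG
    simp
  obtain ⟨u, v, huv⟩ := support_nonempty_iff.mpr hG
  obtain ⟨n, c, hc, -, -, hn, hprod⟩ := hA u v huv
  obtain ⟨ℓ, rfl⟩ := hn.two_dvd
  have h3 := hc.three_le
  rw [Nat.mul_div_cancel_left _ (by norm_num)] at hprod
  have hdeg : ∀ i z, G.Adj (c i) z → z = c (i + 1) ∨ z = c (i + (2 * ℓ - 1)) :=
    fun i z hz => hc.eq_or_eq_of_adj h2 hz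
  set G' := G.isolate (Set.range c) with hG'
  have hih := ih _ (hN ▸ ncard_edgeSet_isolate_lt ⟨0, rfl⟩ (hc.adj 0)) (G := G')
    (h2.mono (isolate_le _)) (fun u v huv => by
      obtain ⟨m, d, hd, rfl, rfl, h5⟩ := hA u v huv.1
      have hdc : ∀ i, d i ∉ Set.range c := fun i hi =>
        huv.2.1 (hc.range_subset h2 hd hi ⟨0, rfl⟩)
      exact ⟨m, d, { hd with adj := fun i => ⟨hd.adj i, hdc _, hdc _⟩ }, rfl, rfl, h5⟩) rfl
  have hcyc : G.cyclomaticNumber = G'.cyclomaticNumber + 1 := by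
    rw [cyclomaticNumber_deleteEdges_of_cyclePart (hc.cyclePart.adj 0)]
    -- Once one edge is gone, the remaining edges of this cycle are bridges and cost nothing.
    rw [cyclomaticNumber_eq_of_cyclePart_le (H := G') (isolate_le_deleteEdges ⟨0, rfl⟩)]
    have key : ∀ x y, (G.deleteEdges {s(c 0, c (0 + 1))}).cyclePart.Adj x y →
        x ∉ Set.range c := by
      rintro x y hxy ⟨i, rfl⟩
      obtain ⟨m, d, hd, hd0, -⟩ := exists_isCyclicSeq_of_cyclePart_adj hxy
      have hd' := hd.mono (deleteEdges_le _)
      obtain ⟨j, hj⟩ := hd'.range_subset h2 hc (j := i) ⟨0, hd0⟩ ⟨0, rfl⟩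
      obtain ⟨k, hk, -⟩ := hd'.exists_edge_of_adj h2 (i := j) (hj ▸ hc.adj 0)
      have := hd.adj k
      rw [deleteEdges_adj, ← hk, hj] at this
      exact this.2 rfl
    exact fun x y hxy => ⟨deleteEdges_le _ hxy.1, key x y hxy, key y x hxy.symm⟩
  -- The null vector makes the deletion of `c 0` free; the other ℓ - 1 even vertices cost at most 1
  -- each, and no edge of the cycle is left.
  have hind : a.index G + 1 ≤ a.index G' + ℓ := by
    obtain ⟨w, hw, hw0⟩ := a.exists_mulVec_eq_zero hc hdeg hprod
    have h5 := a.index_le_isolate_of_mulVec_eq_zero hw hw0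
    set E := {x | ∃ k, x = c (2 * k)} with hE
    have h6 := a.index_le_isolate_add_ncard (G.isolate {c 0}) (E \ {c 0})
    have h0 : c 0 ∈ E := ⟨0, rfl⟩
    have h7 := Set.ncard_sdiff_singleton_add_one h0 (Set.toFinite _)
    rw [hc.ncard_alternate] at h7
    rw [isolate_isolate, Set.union_sdiff_cancel (by simpa using h0)] at h6
    have hle : ∀ x y, (G.isolate E).Adj x y → x ∉ Set.range c := by
      rintro x y hxy ⟨i, rfl⟩
      rcases Nat.even_or_odd' i with ⟨k, rfl | rfl⟩
      · exact hxy.2.1 ⟨k, rfl⟩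
      · rcases hdeg _ _ hxy.1 with h' | h'
        · exact hxy.2.2 ⟨k + 1, h'⟩
        · exact hxy.2.2 ⟨k + ℓ, by rw [h']; congr 1; omega⟩
    have h8 : G.isolate E = G' := by
      refine le_antisymm (fun x y hxy => ⟨hxy.1, hle x y hxy, hle y x hxy.symm⟩)
        (isolate_anti ?_)
      rintro _ ⟨k, rfl⟩
      exact ⟨_, rfl⟩
    rw [h8] at h6
    omega
  have hmat : G'.matchingNumber + ℓ ≤ G.matchingNumber := by
    have := matchingNumber_isolate_seq_add_le (G := G) (c := c) ℓ
      (fun i hi j hj h' => hc.eq_of_lt hi hj h') (fun i _ => hc.adj _)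
    have h5 : {x | ∃ i < 2 * ℓ, x = c i} = Set.range c := by
      ext x
      constructor
      · rintro ⟨i, -, rfl⟩
        exact ⟨_, rfl⟩
      · rintro ⟨i, rfl⟩
        exact ⟨i % (2 * ℓ), Nat.mod_lt _ (by omega), (hc.apply_mod i).symm⟩
    rwa [h5] at this
  omega

/-- Sufficient conditions for the lower bound to be attained. -/
theorem tight_of_cover (h2 : G.cyclePart.MaxDegTwo)
    (hA : ∀ u v, G.cyclePart.Adj u v → ∃ n c, G.IsCyclicSeq n c ∧ c 0 = u ∧ c 1 = v ∧ Even n ∧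
      ∏ j ∈ Finset.range n, a.toFun (c j) (c (j + 1)) = (-1) ^ (n / 2))
    {K : Set V} (hK : Disjoint K G.cyclePart.support)
    (hcov : ∀ u v, G.Adj u v → ¬ G.cyclePart.Adj u v → u ∈ K ∨ v ∈ K)
    (hcard : K.ncard ≤ (G.isolate G.cyclePart.support).matchingNumber) : a.Tight G := by
  have h3 := a.index_add_cyclomaticNumber_le h2 fun u v huv => by
    obtain ⟨n, c, hc, h⟩ := hA u v huv
    exact ⟨n, c, hc.cyclePart, h⟩
  have h4 := cyclomaticNumber_eq_of_cyclePart_le (G.cyclePart_le) le_rfl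
  have h5 := a.index_le_isolate_add_ncard G K
  -- Deleting `K` removes all bridges and no cycle edge. A matching of the cycles and one avoiding
  -- the cycle vertices then combine in `G`.
  have h6 : G.isolate K = G.cyclePart := by
    refine le_antisymm (fun x y hxy => ?_) fun x y hxy => ⟨hxy.1, ?_, ?_⟩
    · by_contra hn
      exact (hcov x y hxy.1 hn).elim hxy.2.1 hxy.2.2
    · exact fun hx => Set.disjoint_left.mp hK hx ⟨y, hxy⟩
    · exact fun hy => Set.disjoint_left.mp hK hy ⟨x, hxy.symm⟩
  have h7 := matchingNumber_add_le (G.isolate_le G.cyclePart.support) G.cyclePart_le (by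
    rw [Set.disjoint_left]
    rintro x ⟨y, hy⟩ hx
    exact hy.2.1 hx)
  have h8 := a.matchingNumber_sub_cyclomaticNumber_le G
  rw [h6] at h5
  unfold Tight
  omega

end UnitWeight

/-! ### Contraction of the cycles -/

namespace SimpleGraph

variable {V : Type*} {G : SimpleGraph V}

lemma cyclePart_adj_of_mem_edges {v x y : V} {p : G.Walk v v} (hp : p.IsCycle)
    (h : s(x, y) ∈ p.edges) : G.cyclePart.Adj x y :=
  adj_and_reachable_delete_edges_iff_exists_cycle.mpr ⟨v, p, hp, h⟩

lemma cyclePart_reachable_of_mem_support {v x y : V} {p : G.Walk v v} (hp : p.IsCycle)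
    (hx : x ∈ p.support) (hy : y ∈ p.support) : G.cyclePart.Reachable x y := by
  have key : ∀ z ∈ p.support, G.cyclePart.Reachable v z := by
    classical
    intro z hz
    refine ⟨(p.takeUntil z hz).transfer G.cyclePart fun e he => ?_⟩
    have := p.edges_takeUntil_subset_edges hz he
    induction e with | _ a b => exact cyclePart_adj_of_mem_edges hp this
  exact (key x hx).symm.trans (key y hy)

lemma mem_cyclePart_support_of_mem_support {v x : V} {p : G.Walk v v} (hp : p.IsCycle)
    (hx : x ∈ p.support) : x ∈ G.cyclePart.support := by
  have : x ∈ Set.range (fun i => p.getVert (i % p.length)) := by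
    rwa [hp.range_getVert_mod]
  exact hp.isCyclicSeq.cyclePart.range_subset_support this

lemma cycleVertices_eq : G.cycleVertices = G.cyclePart.support := by
  ext x
  constructor
  · rintro ⟨_, ⟨v, p, hp, rfl⟩, hx⟩
    exact mem_cyclePart_support_of_mem_support hp (p.mem_verts_toSubgraph.mp hx)
  · rintro ⟨y, hy⟩
    obtain ⟨p, hp, -⟩ := exists_isCycle_of_cyclePart_adj hy
    exact ⟨_, ⟨x, p, hp, rfl⟩, p.mem_verts_toSubgraph.mpr p.start_mem_support⟩

/-- The contracted classes are the components of the union of the cycles, with no disjointness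
assumed. -/
lemma mk_eq_mk_iff {x y : V} : (Quotient.mk G.cycleSetoid x = Quotient.mk G.cycleSetoid y) ↔
    G.cyclePart.Reachable x y := by
  rw [Quotient.eq]
  constructor
  · intro h
    have h' : Relation.EqvGen (fun u v =>
      ∃ C : G.Subgraph, G.IsCycleSubgraph C ∧ u ∈ C.verts ∧ v ∈ C.verts) x y := h
    induction h' with
    | rel u v huv =>
      obtain ⟨_, ⟨w, p, hp, rfl⟩, hu, hv⟩ := huv
      exact cyclePart_reachable_of_mem_support hp (p.mem_verts_toSubgraph.mp hu)
        (p.mem_verts_toSubgraph.mp hv)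
    | refl u => exact Reachable.refl _
    | symm u v h1 ih => exact (ih h1).symm
    | trans u v w h1 h2 ih1 ih2 => exact (ih1 h1).trans (ih2 h2)
  · rintro ⟨p⟩
    induction p with
    | nil => exact Relation.EqvGen.refl _
    | @cons u v w h p ih =>
      refine Relation.EqvGen.trans _ _ _ (Relation.EqvGen.rel _ _ ?_) ih
      obtain ⟨p, hp, -, he⟩ := exists_isCycle_of_cyclePart_adj h
      exact ⟨_, ⟨u, p, hp, rfl⟩, p.mem_verts_toSubgraph.mpr p.start_mem_support,
        p.mem_verts_toSubgraph.mpr (p.snd_mem_support_of_mem_edges he)⟩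

lemma eq_of_mk_eq_mk {x y : V} (hx : x ∉ G.cyclePart.support)
    (h : Quotient.mk G.cycleSetoid x = Quotient.mk G.cycleSetoid y) : x = y := by
  obtain ⟨p⟩ := mk_eq_mk_iff.mp h
  cases p with
  | nil => rfl
  | cons h p => exact absurd ⟨_, h⟩ hx

lemma mk_ne_mk_of_not_cyclePart_adj {x y : V} (h : G.Adj x y) (hn : ¬ G.cyclePart.Adj x y) :
    Quotient.mk G.cycleSetoid x ≠ Quotient.mk G.cycleSetoid y := by
  intro he
  refine hn ⟨h, (mk_eq_mk_iff.mp he).mono fun u v huv => ?_⟩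
  rw [deleteEdges_adj]
  refine ⟨huv.1, fun he => hn ?_⟩
  rw [Set.mem_singleton_iff, Sym2.eq_iff] at he
  rcases he with ⟨rfl, rfl⟩ | ⟨rfl, rfl⟩
  · exact huv
  · exact huv.symm

lemma cycleContraction_adj_iff {A B : Quotient G.cycleSetoid} : G.cycleContraction.Adj A B ↔
    ∃ x y, G.Adj x y ∧ ¬ G.cyclePart.Adj x y ∧ Quotient.mk G.cycleSetoid x = A ∧
      Quotient.mk G.cycleSetoid y = B := by
  rw [cycleContraction, map_adj']
  constructor
  · rintro ⟨hne, x, y, hxy, rfl, rfl⟩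
    exact ⟨x, y, hxy, fun h => hne (mk_eq_mk_iff.mpr h.reachable), rfl, rfl⟩
  · rintro ⟨x, y, hxy, hn, rfl, rfl⟩
    exact ⟨mk_ne_mk_of_not_cyclePart_adj hxy hn, x, y, hxy, rfl, rfl⟩

/-- Contracting the cycles of a graph yields a forest. -/
lemma cyclePart_cycleContraction : G.cycleContraction.cyclePart = ⊥ := by
  ext A B
  simp only [bot_adj, iff_false]
  rintro ⟨hAB, hr⟩
  obtain ⟨x, y, hxy, hn, rfl, rfl⟩ := cycleContraction_adj_iff.mp hAB
  set R := G.deleteEdges {s(x, y)} with hR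
  have hle : G.cyclePart ≤ R := by
    intro u v huv
    rw [hR, deleteEdges_adj]
    refine ⟨huv.1, fun he => hn ?_⟩
    rw [Set.mem_singleton_iff, Sym2.eq_iff] at he
    rcases he with ⟨rfl, rfl⟩ | ⟨rfl, rfl⟩
    · exact huv
    · exact huv.symm
  -- Components of `G` minus the bridge `x y` are unions of classes, so a detour around the
  -- contracted edge would give one around `x y`.
  let f : Quotient G.cycleSetoid → R.ConnectedComponent :=
    Quotient.lift R.connectedComponentMk fun u v huv =>
      ConnectedComponent.sound ((mk_eq_mk_iff.mp (Quotient.sound huv)).mono hle)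
  have hf : ∀ A B, (G.cycleContraction.deleteEdges {s(Quotient.mk G.cycleSetoid x,
      Quotient.mk G.cycleSetoid y)}).Reachable A B → f A = f B := by
    rintro A B ⟨p⟩
    induction p with
    | nil => rfl
    | @cons A B C h p ih =>
      rw [← ih]
      rw [deleteEdges_adj] at h
      obtain ⟨u, v, huv, -, rfl, rfl⟩ := cycleContraction_adj_iff.mp h.1
      refine ConnectedComponent.sound (Adj.reachable ?_)
      rw [hR, deleteEdges_adj]
      refine ⟨huv, fun he => h.2 ?_⟩
      rw [Set.mem_singleton_iff, Sym2.eq_iff] at he ⊢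
      rcases he with ⟨rfl, rfl⟩ | ⟨rfl, rfl⟩
      · exact Or.inl ⟨rfl, rfl⟩
      · exact Or.inr ⟨rfl, rfl⟩
  exact hn ⟨hxy, ConnectedComponent.exact (hf _ _ hr)⟩

lemma matchingNumber_induce_compl [Finite V] (O : Set V) :
    (G.induce Oᶜ).matchingNumber = (G.isolate O).matchingNumber := by
  apply le_antisymm
  · exact matchingNumber_le_of_embedding (Function.Embedding.subtype _)
      fun u v h => ⟨h, u.2, v.2⟩
  · obtain ⟨M, hM, h1, h2⟩ := exists_maxDegOne (G.isolate O)
    let f : ↥(Oᶜ) ↪ V := Function.Embedding.subtype _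
    have h3 : (M.comap f).MaxDegOne := fun x a b ha hb => Subtype.ext (h1 ha hb)
    have h4 : (M.comap f).map f = M := by
      ext u v
      rw [map_adj]
      constructor
      · rintro ⟨x, y, hxy, rfl, rfl⟩
        exact hxy
      · intro h
        exact ⟨⟨u, (hM h).2.1⟩, ⟨v, (hM h).2.2⟩, h, rfl, rfl⟩
    have h5 := h3.ncard_le_matchingNumber (G := G.induce Oᶜ) fun x y h => (hM h).1
    rwa [← h2, ← h4, edgeSet_map,
      Set.ncard_image_of_injective _ (Function.Embedding.injective _)]

lemma matchingNumber_isolate_le_cycleContraction [Finite V] :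
    (G.isolate G.cyclePart.support).matchingNumber ≤ G.cycleContraction.matchingNumber := by
  rw [← matchingNumber_induce_compl]
  refine matchingNumber_le_of_embedding
    ⟨fun x : ↥(G.cyclePart.supportᶜ) => Quotient.mk G.cycleSetoid x.1, fun x y h =>
      Subtype.ext (eq_of_mk_eq_mk x.2 h)⟩ fun u v h => ?_
  exact cycleContraction_adj_iff.mpr ⟨u, v, h, fun h' => u.2 ⟨_, h'⟩, rfl, rfl⟩

/-- Contracting the cycles does not increase the matching number of the graph induced on the
vertices on no cycle if and only if a small set of such vertices covers all edges on no cycle. -/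
lemma matchingNumber_cycleContraction_eq_iff [Finite V] :
    G.cycleContraction.matchingNumber = (G.isolate G.cyclePart.support).matchingNumber ↔
      ∃ K : Set V, Disjoint K G.cyclePart.support ∧
        (∀ u v, G.Adj u v → ¬ G.cyclePart.Adj u v → u ∈ K ∨ v ∈ K) ∧
        K.ncard ≤ (G.isolate G.cyclePart.support).matchingNumber := by
  constructor
  · intro h
    obtain ⟨Q, hQ, hcard⟩ := exists_cover_of_cyclePart_eq_bot (G.cyclePart_cycleContraction)
    set K : Set V := {x | x ∉ G.cyclePart.support ∧ Quotient.mk G.cycleSetoid x ∈ Q} with hK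
    have hinj : Set.InjOn (Quotient.mk G.cycleSetoid) K := fun x hx y _ hxy =>
      eq_of_mk_eq_mk hx.1 hxy
    have himg : Quotient.mk G.cycleSetoid '' K ⊆ Q := by
      rintro _ ⟨x, hx, rfl⟩
      exact hx.2
    -- The members of `Q` off the cycles already cover G - O(G), so by count they are all of `Q`:
    -- the cover contains no contracted cycle.
    have h1 : (G.isolate G.cyclePart.support).matchingNumber ≤ K.ncard :=
      matchingNumber_le_of_cover fun u v huv => by
        refine (hQ _ _ (cycleContraction_adj_iff.mpr ⟨u, v, huv.1, fun h' => huv.2.1 ⟨_, h'⟩,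
          rfl, rfl⟩)).imp (fun h' => ⟨huv.2.1, h'⟩) fun h' => ⟨huv.2.2, h'⟩
    have h2 := Set.ncard_le_ncard himg (Set.toFinite _)
    rw [hinj.ncard_image] at h2
    have h3 : Quotient.mk G.cycleSetoid '' K = Q :=
      Set.eq_of_subset_of_ncard_le himg (by rw [hinj.ncard_image]; omega) (Set.toFinite _)
    have h4 : ∀ x, Quotient.mk G.cycleSetoid x ∈ Q → x ∈ K := by
      intro x hx
      rw [← h3] at hx
      obtain ⟨y, hy, hyx⟩ := hx
      rwa [← eq_of_mk_eq_mk hy.1 hyx]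
    refine ⟨K, ?_, fun u v huv hn => ?_, by omega⟩
    · rw [Set.disjoint_left]
      exact fun x hx => hx.1
    · exact (hQ _ _ (cycleContraction_adj_iff.mpr ⟨u, v, huv, hn, rfl, rfl⟩)).imp (h4 u) (h4 v)
  · rintro ⟨K, -, hcov, hcard⟩
    refine le_antisymm ?_ matchingNumber_isolate_le_cycleContraction
    have h1 : G.cycleContraction.matchingNumber ≤ (Quotient.mk G.cycleSetoid '' K).ncard := by
      refine matchingNumber_le_of_cover fun A B hAB => ?_
      obtain ⟨x, y, hxy, hn, rfl, rfl⟩ := cycleContraction_adj_iff.mp hAB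
      exact (hcov x y hxy hn).imp (fun h => ⟨x, h, rfl⟩) fun h => ⟨y, h, rfl⟩
    have h2 := Set.ncard_image_le (f := Quotient.mk G.cycleSetoid) (s := K) (Set.toFinite _)
    omega

/-- A cycle uses two edges at each of its vertices, and the degree bound leaves no room for a third
edge lying on a cycle. -/
lemma cyclePart_walk_mem {x y : V} {v : V} {p : G.Walk v v} (hp : p.IsCycle)
    (h2 : G.cyclePart.MaxDegTwo) (hx : x ∈ p.support) (hxy : G.cyclePart.Adj x y) :
    p.toSubgraph.Adj x y := by
  have h3 := hp.ncard_neighborSet_toSubgraph_eq_two hx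
  obtain ⟨a, b, hab, hs⟩ := Set.ncard_eq_two.mp h3
  have hadj : ∀ z, p.toSubgraph.Adj x z → G.cyclePart.Adj x z := fun z hz =>
    cyclePart_adj_of_mem_edges hp ((p.mem_edges_toSubgraph).mp hz)
  have ha : p.toSubgraph.Adj x a := by
    have : a ∈ p.toSubgraph.neighborSet x := by rw [hs]; simp
    exact this
  have hb : p.toSubgraph.Adj x b := by
    have : b ∈ p.toSubgraph.neighborSet x := by rw [hs]; simp
    exact this
  rcases h2 (hadj a ha) (hadj b hb) hxy with h | h | h
  · exact absurd h hab
  · exact h ▸ ha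
  · exact h ▸ hb

lemma toSubgraph_le_of_mem_support {v w z : V} {p : G.Walk v v} {q : G.Walk w w}
    (hp : p.IsCycle) (hq : q.IsCycle) (h2 : G.cyclePart.MaxDegTwo) (hzp : z ∈ p.support)
    (hzq : z ∈ q.support) : q.toSubgraph ≤ p.toSubgraph := by
  have key : ∀ x, G.cyclePart.Reachable z x → x ∈ p.support := by
    rintro x ⟨r⟩
    induction r with
    | nil => exact hzp
    | cons h r ih =>
      have h' := cyclePart_walk_mem hp h2 hzp h
      exact (ih (p.mem_verts_toSubgraph.mp (p.toSubgraph.edge_vert h'.symm)) (by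
        have h'' := cyclePart_walk_mem hq h2 hzq h
        exact q.mem_verts_toSubgraph.mp (q.toSubgraph.edge_vert h''.symm)))
  have hmem : ∀ x ∈ q.support, x ∈ p.support := fun x hx =>
    key x (cyclePart_reachable_of_mem_support hq hzq hx)
  refine ⟨fun x hx => p.mem_verts_toSubgraph.mpr (hmem x (q.mem_verts_toSubgraph.mp hx)),
    fun x y hxy => cyclePart_walk_mem hp h2 (hmem x ?_) ?_⟩
  · exact q.mem_verts_toSubgraph.mp (q.toSubgraph.edge_vert hxy)
  · exact cyclePart_adj_of_mem_edges hq ((q.mem_edges_toSubgraph).mp hxy)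

lemma cyclesVertexDisjoint_iff : G.CyclesVertexDisjoint ↔ G.cyclePart.MaxDegTwo := by
  constructor
  · intro h x a b d ha hb hd
    by_contra! hne
    obtain ⟨p, hp, -, hpa⟩ := exists_isCycle_of_cyclePart_adj ha
    have key : ∀ y, G.cyclePart.Adj x y → p.toSubgraph.Adj x y := by
      intro y hy
      obtain ⟨q, hq, -, hqy⟩ := exists_isCycle_of_cyclePart_adj hy
      have heq : p.toSubgraph = q.toSubgraph := by
        by_contra hpq
        exact Set.disjoint_left.mp (h _ _ ⟨x, p, hp, rfl⟩ ⟨x, q, hq, rfl⟩ hpq)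
          (p.mem_verts_toSubgraph.mpr p.start_mem_support)
          (q.mem_verts_toSubgraph.mpr q.start_mem_support)
      rw [heq]
      exact (q.mem_edges_toSubgraph).mpr hqy
    -- By disjointness every cycle through `x` is the same one, so all non-bridges at `x` are among
    -- its two edges there.
    have h3 := hp.ncard_neighborSet_toSubgraph_eq_two p.start_mem_support
    obtain ⟨y, z, -, hs⟩ := Set.ncard_eq_two.mp h3
    have hmem : ∀ t, G.cyclePart.Adj x t → t = y ∨ t = z := by
      intro t ht
      have : t ∈ p.toSubgraph.neighborSet x := key t ht
      rwa [hs] at this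
    grind
  · rintro h _ _ ⟨v, p, hp, rfl⟩ ⟨w, q, hq, rfl⟩ hne
    rw [Set.disjoint_left]
    intro z hzp hzq
    rw [Walk.mem_verts_toSubgraph] at hzp hzq
    exact hne (le_antisymm (toSubgraph_le_of_mem_support hq hp h hzq hzp)
      (toSubgraph_le_of_mem_support hp hq h hzp hzq))

end SimpleGraph

/-! ### Gain graphs as weighted graphs, and the theorem -/

namespace ComplexUnitGain

open SimpleGraph

variable {V : Type*} {G : SimpleGraph V} (φ : ComplexUnitGain G)

open Classical in
/-- The gains, extended by `1` to the pairs of non-adjacent vertices. -/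
noncomputable def toUnitWeight : UnitWeight V where
  toFun u v := if h : G.Adj u v then (φ.gain ⟨(u, v), h⟩ : ℂ) else 1
  star_toFun u v := by
    by_cases h : G.Adj u v
    · have key : φ.gain ⟨(v, u), h.symm⟩ = (φ.gain ⟨(u, v), h⟩)⁻¹ := φ.gain_symm ⟨(u, v), h⟩
      simp only [h, h.symm, dite_true, key, Circle.coe_inv_eq_conj]
      rfl
    · have h' : ¬ G.Adj v u := fun h' => h h'.symm
      simp [h, h']
  mul_toFun u v := by
    by_cases h : G.Adj u v
    · have key : φ.gain ⟨(v, u), h.symm⟩ = (φ.gain ⟨(u, v), h⟩)⁻¹ := φ.gain_symm ⟨(u, v), h⟩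
      simp only [h, h.symm, dite_true, key, ← Circle.coe_mul, mul_inv_cancel, Circle.coe_one]
    · have h' : ¬ G.Adj v u := fun h' => h h'.symm
      simp [h, h']

lemma toUnitWeight_of_adj {u v : V} (h : G.Adj u v) :
    φ.toUnitWeight.toFun u v = φ.gain ⟨(u, v), h⟩ := dif_pos h

lemma adjMat_toUnitWeight : φ.toUnitWeight.adjMat G = φ.adjMatrix := by
  ext i j
  by_cases h : G.Adj i j
  · rw [UnitWeight.adjMat_of_adj _ h, φ.toUnitWeight_of_adj h]
    simp [adjMatrix, h]
  · rw [UnitWeight.adjMat_of_not_adj _ h]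
    simp [adjMatrix, h]

lemma posInertia_eq [Fintype V] [DecidableEq V] : φ.posInertia = φ.toUnitWeight.index G := by
  rw [posInertia, ← Matrix.IsHermitian.posIndex_eq, UnitWeight.index, adjMat_toUnitWeight]

lemma walkGain_eq {u v : V} (p : G.Walk u v) : φ.walkGain p =
    ∏ j ∈ Finset.range p.length, φ.toUnitWeight.toFun (p.getVert j) (p.getVert (j + 1)) := by
  induction p with
  | nil => simp [walkGain]
  | @cons u v w h p ih =>
    rw [Walk.length_cons, Finset.prod_range_succ']
    simp only [Walk.getVert_cons_succ, Walk.getVert_zero]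
    rw [← ih, φ.toUnitWeight_of_adj h]
    simp only [walkGain, Walk.darts_cons, List.map_cons, List.prod_cons]
    rw [mul_comm]

/-- Indices modulo the length match the periodic sequence of `Walk.IsCycle.isCyclicSeq`. -/
lemma walkGain_eq_of_closed {v : V} (p : G.Walk v v) : φ.walkGain p =
    ∏ j ∈ Finset.range p.length, φ.toUnitWeight.toFun (p.getVert (j % p.length))
      (p.getVert ((j + 1) % p.length)) := by
  rw [walkGain_eq]
  refine Finset.prod_congr rfl fun j hj => ?_
  rw [Finset.mem_range] at hj
  rw [Nat.mod_eq_of_lt hj]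
  rcases Nat.lt_or_ge (j + 1) p.length with h | h
  · rw [Nat.mod_eq_of_lt h]
  · have : j + 1 = p.length := by omega
    rw [this, Nat.mod_self]
    simp

end ComplexUnitGain

theorem theorem3p9 {V : Type*} [Fintype V] [DecidableEq V] (G : SimpleGraph V)
    (φ : ComplexUnitGain G) (hG : G.Connected) :
    (φ.posInertia : ℤ) = (G.matchingNumber : ℤ) - G.cyclomaticNumber ↔
      G.CyclesVertexDisjoint ∧
      (∀ C : G.Subgraph, G.IsCycleSubgraph C → φ.IsTypeA C) ∧
      G.cycleContraction.matchingNumber = (G.induce (G.cycleVerticesᶜ)).matchingNumber := by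
  rw [φ.posInertia_eq, SimpleGraph.matchingNumber_induce_compl, SimpleGraph.cycleVertices_eq,
    SimpleGraph.matchingNumber_cycleContraction_eq_iff, SimpleGraph.cyclesVertexDisjoint_iff]
  constructor
  · intro h
    have ht : φ.toUnitWeight.Tight G := h
    obtain ⟨K, h1, h2, h3, -⟩ := ht.exists_cover
    refine ⟨ht.maxDegTwo, fun C _ v p hp _ => ?_, K, h1, h2, h3⟩
    rw [φ.walkGain_eq_of_closed p]
    exact ht.prod_eq hp.isCyclicSeq
  · rintro ⟨h2, hA, K, hK1, hK2, hK3⟩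
    refine φ.toUnitWeight.tight_of_cover h2 (fun u v huv => ?_) hK1 hK2 hK3
    obtain ⟨p, hp, hp1, -⟩ := SimpleGraph.exists_isCycle_of_cyclePart_adj huv
    have h3 := hp.three_le_length
    have := hA _ ⟨u, p, hp, rfl⟩ u p hp rfl
    rw [φ.walkGain_eq_of_closed p] at this
    exact ⟨_, _, hp.isCyclicSeq, by simp, by simp [Nat.mod_eq_of_lt (by omega : 1 < p.length), hp1],
      this⟩
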